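/- Let $q\ge 1$ and let $\vec n=(n_1,\dots,n_q)$ be integers with $n_i\ge 2$; put $|\vec n|=\prod_{i=1}^q n_i$. Let $Y$ be the periodic $q$-cubical lattice with side lengths $\vec n$, realized in the torus $\prod_{i=1}^q\mathbb R/n_i\mathbb Z$: for $0\le k\le q$ its $k$-cubes are the sets $I_1\times\cdots\times I_q$ in which exactly $k$ of the factors $I_i$ are unit intervals, i.e. among $[0,1],[1,2],\dots,[n_i-1,0]\subset\mathbb R/n_i\mathbb Z$, and the other factors are degenerate intervals, i.e. among $[0,0],[1,1],\dots,[n_i-1,n_i-1]$. A closed geodesic of length $m\ge 1$ in $Y$ is a sequence $c=(\tau_0,\sigma_0,\tau_1,\sigma_1,\dots,\tau_{m-1},\sigma_{m-1})$ of $(q-1)$-cubes $\tau_i$ and $q$-cubes $\sigma_i$ such that $\tau_i\ne\tau_{i+1}$, $\tau_{i+1}\subset\sigma_i\cap\sigma_{i+1}$ and $\sigma_i\neq\sigma_{i+1}$ for all $i\in\mathbb Z/m\mathbb Z$. It is prime if it is not an $r$-fold repetition, $r\ge 2$, of a closed geodesic. A prime cycle is a class $\mathfrak p$ of prime closed geodesics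 up to cyclic permutation (of the indices $i$), and $|\mathfrak p|$ is the length of its representatives. For $u\in\mathbb C$ with $|u|$ sufficiently small, the (Ihara) zeta function of $Y$ is $$\zeta_Y(u)=\prod_{\mathfrak p}\bigl(1-u^{|\mathfrak p|}\bigr)^{-1},$$ the product being over all prime cycles $\mathfrak p$ of $Y$. Let $J_1=J_2=\{1\}$ and $J_d=\{j\in\mathbb N: j<d/2,\ \gcd(j,d)=1\}$ for $d\ge 3$, where $\mathbb N=\{1,2,\dots\}$, and for $\vec d=(d_1,\dots,d_q)\in\mathbb N^q$ let $$\Psi_{\vec d}(x,y)=\prod_{j_1\in J_{d_1}}\cdots\prod_{j_q\in J_{d_q}}\Bigl(x-2y\sum_{i=1}^q\cos\frac{2\pi j_i}{d_i}\Bigr),\qquad \epsilon(\vec d)=2^{\#\{1\le i\le q\,:\,d_i\ge 3\}}.$$ Then there is $r>0$ (depending on $\vec n$) such that for all $u\in\mathbb C$ with $|u|<r$ the product defining $\zeta_Y(u)$ converges unconditionally and $$\zeta_Y(u)^{-1}=(1-u^2)^{(q-1)|\vec n|}\prod_{\vec d\mid\vec n}\Psi_{\vec d}\bigl(1+(2q-1)u^2,\,u\bigr)^{\epsilon(\vec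 d)},$$ where $\vec d\mid\vec n$ means that $d_i\mid n_i$ for all $i=1,\dots,q$. -/

import Mathlib

noncomputable section

namespace CubicalLattice

/-- The torus `∏ i, ℝ / n i ℤ` in which the lattice with side lengths `n` is realized. -/
abbrev Torus {q : ℕ} (n : Fin q → ℕ) : Type := ∀ i, AddCircle ((n i : ℕ) : ℝ)

/-- The image in `ℝ / m ℤ` of the real interval `[a, b]`. -/
def interval (m : ℕ) (a b : ℝ) : Set (AddCircle (m : ℝ)) :=
  (fun x : ℝ => (x : AddCircle (m : ℝ))) '' Set.Icc a b

/-- The unit intervals `[0,1], [1,2], …, [m-1,0]` of `ℝ / m ℤ`. -/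
def unitIntervals (m : ℕ) : Set (Set (AddCircle (m : ℝ))) :=
  {I | ∃ v : ℕ, v < m ∧ I = interval m (v : ℝ) ((v : ℝ) + 1)}

/-- The degenerate intervals `[0,0], [1,1], …, [m-1,m-1]` of `ℝ / m ℤ`. -/
def pointIntervals (m : ℕ) : Set (Set (AddCircle (m : ℝ))) :=
  {I | ∃ v : ℕ, v < m ∧ I = interval m (v : ℝ) (v : ℝ)}

/-- The elementary cubes `I₁ × ⋯ × I_q` with `I_i` a unit interval if `i ∈ s` and a degenerate
interval otherwise. -/
def cubesOn {q : ℕ} (n : Fin q → ℕ) (s : Finset (Fin q)) : Set (Set (Torus n)) :=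
  {c | ∃ I : ∀ i, Set (AddCircle ((n i : ℕ) : ℝ)),
    (∀ i, (i ∈ s → I i ∈ unitIntervals (n i)) ∧ (i ∉ s → I i ∈ pointIntervals (n i))) ∧
      c = Set.univ.pi I}

/-- The `k`-cubes of the periodic cubical lattice with side lengths `n`
(over the complete simplicial complex on the `q` directions). -/
def cubes {q : ℕ} (n : Fin q → ℕ) (k : ℕ) : Set (Set (Torus n)) :=
  {c | ∃ s : Finset (Fin q), s.card = k ∧ c ∈ cubesOn n s}

/-- Pairs `(τ, σ)`, the entries of the sequences below. -/
abbrev CubePair {q : ℕ} (n : Fin q → ℕ) : Type := Set (Torus n) × Set (Torus n)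

/-- The sequence `(τ₀, σ₀, τ₁, σ₁, …, τ_{m-1}, σ_{m-1})`, with `m ≥ 1`, coded by the list of the
pairs `(τ_i, σ_i)`, is a closed path in the `d`-skeleton (`1 ≤ d`): the `τ_i` are `(d-1)`-cubes,
the `σ_i` are `d`-cubes, and for all `i` modulo `m` one has `τ_i ≠ τ_{i+1}` and
`τ_{i+1} ⊆ σ_i ∩ σ_{i+1}`. (`Cycle.Chain` is a condition on all cyclically consecutive entries,
the pair formed by the last and the first entry included.) -/
def IsClosedPath {q : ℕ} (n : Fin q → ℕ) (d : ℕ) (c : List (CubePair n)) : Prop :=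
  c ≠ [] ∧ (∀ a ∈ c, a.1 ∈ cubes n (d - 1) ∧ a.2 ∈ cubes n d) ∧
    Cycle.Chain (fun a b : CubePair n => a.1 ≠ b.1 ∧ b.1 ⊆ a.2 ∩ b.2) (c : Cycle (CubePair n))

/-- A closed geodesic: a closed path without back-tracking, i.e. `σ_i ≠ σ_{i+1}` for all `i`
modulo the length. -/
def IsClosedGeodesic {q : ℕ} (n : Fin q → ℕ) (d : ℕ) (c : List (CubePair n)) : Prop :=
  IsClosedPath n d c ∧ Cycle.Chain (fun a b : CubePair n => a.2 ≠ b.2) (c : Cycle (CubePair n))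

/-- A closed geodesic is prime if it is not the `m`-fold repetition of a closed geodesic with
`m ≥ 2`. -/
def IsPrimeGeodesic {q : ℕ} (n : Fin q → ℕ) (d : ℕ) (c : List (CubePair n)) : Prop :=
  IsClosedGeodesic n d c ∧
    ¬ ∃ (b : List (CubePair n)) (m : ℕ),
      IsClosedGeodesic n d b ∧ 2 ≤ m ∧ c = (List.replicate m b).flatten

/-- The prime cycles of the `d`-skeleton: classes of prime closed geodesics up to cyclic
permutation. -/
def primeCycles {q : ℕ} (n : Fin q → ℕ) (d : ℕ) : Set (Cycle (CubePair n)) :=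
  {p | ∃ c : List (CubePair n), IsPrimeGeodesic n d c ∧ p = (c : Cycle (CubePair n))}

/-- The Euler factor `(1 - u^|p|)⁻¹` of a prime cycle `p`. -/
def eulerFactor {q : ℕ} (n : Fin q → ℕ) (d : ℕ) (u : ℂ) (p : primeCycles n d) : ℂ :=
  (1 - u ^ (p : Cycle (CubePair n)).length)⁻¹

/-- The (Ihara) zeta function of the `d`-skeleton, as an infinite product. -/
def zeta {q : ℕ} (n : Fin q → ℕ) (d : ℕ) (u : ℂ) : ℂ :=
  ∏' p : primeCycles n d, eulerFactor n d u p

/-- `J_1 = J_2 = {1}`, and `J_d = {j : j < d / 2, gcd (j, d) = 1}` for `d ≥ 3`. -/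
def J (d : ℕ) : Finset ℕ :=
  if d ≤ 2 then {1} else (Finset.range d).filter (fun j => 2 * j < d ∧ Nat.gcd j d = 1)

/-- The cyclotomic-like polynomial `Ψ_d(x, y)` for a vector `d`; `X 0` is `x` and `X 1` is `y`. -/
def Psi {q : ℕ} (d : Fin q → ℕ) : MvPolynomial (Fin 2) ℝ :=
  ∏ j ∈ Fintype.piFinset (fun i => J (d i)),
    (MvPolynomial.X 0 -
      MvPolynomial.C (2 * ∑ i, Real.cos (2 * Real.pi * (j i : ℝ) / (d i : ℝ))) *
        MvPolynomial.X 1)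

/-- `ε(d) = 2 ^ #{i : d_i ≥ 3}`. -/
def eps {q : ℕ} (d : Fin q → ℕ) : ℕ :=
  2 ^ (Finset.univ.filter (fun i => 3 ≤ d i)).card

end CubicalLattice

end

/-! Make the `q`-cubes the vertices and the `(q-1)`-cubes the edges of a graph. This is the Cayley
multigraph of `∏ ℤ/n_i` for the steps `±e_i`; where `n_i = 2` the two steps give parallel edges. It
is `2q`-regular, and closed geodesics correspond to closed reduced walks, coded as closed chains of
oriented edges (`bijective_map_edgePair`).

Taking logarithms turns the Euler product into the sum of `u^|c| / |c|` over all closed geodesics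
`c`: each is a unique repetition of a prime one, and a prime one of length `m` has `m` distinct
rotations (`CyclicProperty.hasProd_eulerFactor`). Closed chains of length `m` number `tr W^m`, with
`W` the non-backtracking edge matrix, so the sum exponentiates to `det(1 - uW)⁻¹`
(`exists_hasSum_isClosedChain`).

Bass's identity (`Matrix.bass_formula`) reduces `det(1 - uW)` to the determinant of `(1 + (2q-1)u²)
- uA`, with `A` the adjacency matrix. The characters of `∏ ℤ/n_i` diagonalize `A` with eigenvalues
`∑ 2 cos(2π k_i / n_i)`. Writing each `k_i / n_i` in lowest terms and identifying `k_i` with `-k_i`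
collects the factors into powers of the `Ψ_d` (`prod_cos_eq_prod_divisors`). -/

/-! ### Traces of powers and determinants in terms of eigenvalues -/

namespace Matrix

variable {X : Type*} [Fintype X] [DecidableEq X]

theorem det_scalar_sub_eq_prod_roots {K : Type*} [Field K] [IsAlgClosed K] (M : Matrix X X K)
    (c : K) : (scalar X c - M).det = (M.charpoly.roots.map fun a => c - a).prod := by
  rw [← eval_charpoly, (IsAlgClosed.splits M.charpoly).eval_eq_prod_roots_of_monic
    M.charpoly_monic]

theorem card_roots_charpoly {K : Type*} [Field K] [IsAlgClosed K] (M : Matrix X X K) :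
    M.charpoly.roots.card = Fintype.card X := by
  rw [← (IsAlgClosed.splits M.charpoly).natDegree_eq_card_roots, charpoly_natDegree_eq_dim]

theorem det_sub_scalar_eq_prod_roots {K : Type*} [Field K] [IsAlgClosed K] (M : Matrix X X K)
    (c : K) : (M - scalar X c).det = (M.charpoly.roots.map fun a => a - c).prod := by
  have h : (M.charpoly.roots.map fun a => a - c) =
      ((M.charpoly.roots.map fun a => c - a).map Neg.neg) := by simp
  rw [← neg_sub, det_neg, det_scalar_sub_eq_prod_roots, h, Multiset.prod_map_neg,
    Multiset.card_map, card_roots_charpoly]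

theorem det_aeval_prod_X_sub_C {K : Type*} [Field K] (M : Matrix X X K) (t : Multiset K) :
    (Polynomial.aeval M (t.map fun b => Polynomial.X - Polynomial.C b).prod).det =
      (t.map fun b => (M - scalar X b).det).prod := by
  induction t using Multiset.induction with
  | empty => simp
  | cons b t ih =>
    rw [Multiset.map_cons, Multiset.prod_cons, map_mul, det_mul, ih, Multiset.map_cons,
      Multiset.prod_cons, map_sub, Polynomial.aeval_X, Polynomial.aeval_C]
    rfl

/-- Both sides are the double product of `a - b` over eigenvalues `a` and roots `b` of `p`, taken in
the two possible orders. This gives spectral mapping with multiplicities without triangularizing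
`M`. -/
theorem det_aeval_eq_prod_roots {K : Type*} [Field K] [IsAlgClosed K] (M : Matrix X X K)
    {p : Polynomial K} (hp : p.Monic) :
    (Polynomial.aeval M p).det = (M.charpoly.roots.map fun a => p.eval a).prod := by
  have hfac := (IsAlgClosed.splits p).eq_prod_roots_of_monic hp
  conv_lhs => rw [hfac]
  rw [det_aeval_prod_X_sub_C]
  simp only [det_sub_scalar_eq_prod_roots, (IsAlgClosed.splits p).eval_eq_prod_roots_of_monic hp]
  exact Multiset.prod_map_prod_map _ _

theorem charpoly_pow_eq_prod_roots {K : Type*} [Field K] [IsAlgClosed K] (M : Matrix X X K)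
    {k : ℕ} (hk : k ≠ 0) :
    (M ^ k).charpoly =
      ((M.charpoly.roots.map fun a => a ^ k).map fun a => Polynomial.X - Polynomial.C a).prod := by
  have : Infinite K := IsAlgClosed.instInfinite
  refine Polynomial.funext fun c => ?_
  have h := M.det_aeval_eq_prod_roots (Polynomial.monic_X_pow_sub_C c hk)
  have h1 : Polynomial.aeval M (Polynomial.X ^ k - Polynomial.C c) = M ^ k - scalar X c := by
    simp only [map_sub, map_pow, Polynomial.aeval_X, Polynomial.aeval_C]
    rfl
  have h2 : (M.charpoly.roots.map fun a => c - a ^ k) =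
      ((M.charpoly.roots.map fun a => (Polynomial.X ^ k - Polynomial.C c).eval a).map Neg.neg) := by
    simp
  rw [h1] at h
  rw [eval_charpoly, ← neg_sub, det_neg, h, Polynomial.eval_multiset_prod, Multiset.map_map,
    Multiset.map_map]
  simp only [Function.comp_def, Polynomial.eval_sub, Polynomial.eval_X, Polynomial.eval_C]
  rw [h2, Multiset.prod_map_neg, Multiset.card_map, card_roots_charpoly]
  simp

theorem trace_pow_eq_sum_roots {K : Type*} [Field K] [IsAlgClosed K] (M : Matrix X X K)
    {k : ℕ} (hk : k ≠ 0) :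
    (M ^ k).trace = (M.charpoly.roots.map fun a => a ^ k).sum := by
  rw [trace_eq_sum_roots_charpoly, charpoly_pow_eq_prod_roots M hk,
    Polynomial.roots_multiset_prod_X_sub_C]

theorem det_one_sub_smul_eq_prod_roots {K : Type*} [Field K] [IsAlgClosed K] (M : Matrix X X K)
    (u : K) : (1 - u • M).det = (M.charpoly.roots.map fun a => 1 - u * a).prod := by
  rcases eq_or_ne u 0 with rfl | hu
  · simp
  have h : 1 - u • M = u • (scalar X u⁻¹ - M) := by
    ext i j
    simp only [sub_apply, smul_apply, scalar_apply, diagonal_apply, one_apply, smul_eq_mul]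
    split_ifs
    · field_simp
    · simp
  rw [h, det_smul, det_scalar_sub_eq_prod_roots, ← M.card_roots_charpoly, ← Multiset.prod_replicate,
    ← Multiset.map_const', ← Multiset.prod_map_mul]
  refine congrArg _ (Multiset.map_congr rfl fun a _ => ?_)
  field_simp

end Matrix

/-- The sum is `-∑ log(1 - u a)`, by the Taylor series of the logarithm at each `a`. -/
theorem Multiset.exists_hasSum_sum_pow_div {u : ℂ} (s : Multiset ℂ) (hs : ∀ a ∈ s, ‖u * a‖ < 1) :
    ∃ S : ℂ, HasSum (fun k : ℕ => (s.map fun a => a ^ (k + 1)).sum * u ^ (k + 1) / (k + 1)) S ∧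
      Complex.exp S = (s.map fun a => 1 - u * a).prod⁻¹ := by
  induction s using Multiset.induction with
  | empty => exact ⟨0, by simp, by simp⟩
  | cons a s ih =>
    obtain ⟨S, hS, hexp⟩ := ih fun b hb => hs b (Multiset.mem_cons_of_mem hb)
    have ha := hs a (Multiset.mem_cons_self a s)
    have hne : 1 - u * a ≠ 0 := by
      intro h
      rw [← sub_eq_zero.mp h] at ha
      simp at ha
    refine ⟨-Complex.log (1 - u * a) + S, ?_, ?_⟩
    · refine ((Complex.hasSum_taylorSeries_neg_log' ha).add hS).congr_fun ?_
      intro k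
      simp only [Multiset.map_cons, Multiset.sum_cons]
      ring
    · rw [Complex.exp_add, Complex.exp_neg, Complex.exp_log hne, hexp, Multiset.map_cons,
        Multiset.prod_cons, mul_inv]

theorem Matrix.exists_hasSum_trace_pow_div {X : Type*} [Fintype X] [DecidableEq X]
    (M : Matrix X X ℂ) : ∃ r : ℝ, 0 < r ∧ ∀ u : ℂ, ‖u‖ < r → ∃ S : ℂ,
      HasSum (fun k : ℕ => (M ^ (k + 1)).trace * u ^ (k + 1) / (k + 1)) S ∧
        Complex.exp S = (1 - u • M).det⁻¹ := by
  obtain ⟨C, hC⟩ := (M.charpoly.roots.toFinset.finite_toSet.image fun a : ℂ => ‖a‖).bddAbove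
  -- `C` bounds the moduli of the eigenvalues; `|C| + 1` is positive even if there are none and `C`
  -- is negative.
  refine ⟨(|C| + 1)⁻¹, by positivity, fun u hu => ?_⟩
  obtain ⟨S, hS, hexp⟩ := M.charpoly.roots.exists_hasSum_sum_pow_div (u := u) fun a ha => by
    have haC : ‖a‖ ≤ |C| := (hC ⟨a, by simpa using ha, rfl⟩).trans (le_abs_self C)
    rw [norm_mul]
    have h1 : ‖u‖ * (|C| + 1) < 1 := by
      have := mul_lt_mul_of_pos_right hu (by positivity : 0 < |C| + 1)
      rwa [inv_mul_cancel₀ (by positivity)] at this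
    nlinarith [norm_nonneg u]
  refine ⟨S, ?_, by rw [hexp, det_one_sub_smul_eq_prod_roots]⟩
  simpa only [trace_pow_eq_sum_roots M (Nat.succ_ne_zero _)] using hS

/-! ### Repetitions and rotations of lists via periodic sequences -/

namespace List

variable {α : Type*}

/-- The left shift of a sequence. -/
def seqShift (f : ℕ → Option α) : ℕ → Option α := fun i => f (i + 1)

theorem iterate_seqShift (f : ℕ → Option α) (k i : ℕ) : seqShift^[k] f i = f (i + k) := by
  induction k generalizing i with
  | zero => rfl
  | succ k ih =>
    rw [Function.iterate_succ_apply']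
    change seqShift^[k] f (i + 1) = _
    rw [ih]
    congr 1
    omega

/-- The periodic sequence that repeats a list (constantly `none` for the empty list). -/
def periodicSeq (l : List α) : ℕ → Option α := fun i => l[i % l.length]?

theorem isPeriodicPt_periodicSeq (l : List α) :
    Function.IsPeriodicPt seqShift l.length l.periodicSeq := by
  funext i
  rw [iterate_seqShift]
  simp [periodicSeq]

theorem eq_of_periodicSeq_eq {l l' : List α} (hlen : l.length = l'.length)
    (h : l.periodicSeq = l'.periodicSeq) : l = l' := by
  refine ext_getElem? fun i => ?_
  rcases lt_or_ge i l.length with hi | hi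
  · have := congrFun h i
    rwa [periodicSeq, periodicSeq, ← hlen, Nat.mod_eq_of_lt hi] at this
  · rw [getElem?_eq_none hi, getElem?_eq_none (hlen ▸ hi)]

theorem periodicSeq_rotate (l : List α) (k : ℕ) :
    (l.rotate k).periodicSeq = seqShift^[k] l.periodicSeq := by
  funext i
  rw [iterate_seqShift]
  rcases Nat.eq_zero_or_pos l.length with h | h
  · simp [length_eq_zero_iff.mp h, periodicSeq]
  · rw [periodicSeq, length_rotate, getElem?_rotate (Nat.mod_lt _ h), periodicSeq]
    simp

theorem length_flatten_replicate (m : ℕ) (b : List α) :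
    (replicate m b).flatten.length = m * b.length := by
  simp

theorem getElem?_flatten_replicate (b : List α) (m i : ℕ) (hi : i < m * b.length) :
    (replicate m b).flatten[i]? = b[i % b.length]? := by
  induction m generalizing i with
  | zero => simp at hi
  | succ m ih =>
    rw [replicate_succ, flatten_cons, getElem?_append]
    split_ifs with h
    · rw [Nat.mod_eq_of_lt h]
    · rw [ih _ (by rw [Nat.succ_mul] at hi; omega), ← Nat.mod_eq_sub_mod (by omega)]

theorem periodicSeq_flatten_replicate (b : List α) {m : ℕ} (hm : m ≠ 0) :
    (replicate m b).flatten.periodicSeq = b.periodicSeq := by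
  funext i
  rcases Nat.eq_zero_or_pos b.length with h | h
  · simp [length_eq_zero_iff.mp h, periodicSeq]
  · rw [periodicSeq, periodicSeq, length_flatten_replicate, getElem?_flatten_replicate _ _ _
      (Nat.mod_lt _ (by positivity)), Nat.mod_mod_of_dvd _ (Dvd.intro_left m rfl)]

theorem periodicSeq_take {l : List α} {d : ℕ} (hd : 0 < d) (hdl : d ≤ l.length)
    (h : Function.IsPeriodicPt seqShift d l.periodicSeq) :
    (l.take d).periodicSeq = l.periodicSeq := by
  funext i
  have h1 : seqShift^[d * (i / d)] l.periodicSeq (i % d) = l.periodicSeq (i % d) := by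
    rw [(h.mul_const (i / d)).eq]
  rw [iterate_seqShift, Nat.mod_add_div] at h1
  have hlt := Nat.mod_lt i hd
  rw [h1, periodicSeq, length_take, min_eq_left hdl, getElem?_take_of_lt hlt, periodicSeq,
    Nat.mod_eq_of_lt (hlt.trans_le hdl)]

/-- A list is determined by its length and its periodic sequence, and both sides share these. -/
theorem eq_flatten_replicate_take {l : List α} {d : ℕ} (hd : 0 < d) (hl : l ≠ [])
    (hdvd : d ∣ l.length) (h : Function.IsPeriodicPt seqShift d l.periodicSeq) :
    l = (replicate (l.length / d) (l.take d)).flatten := by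
  have hpos := length_pos_iff.mpr hl
  have hdl := Nat.le_of_dvd hpos hdvd
  refine eq_of_periodicSeq_eq ?_ ?_
  · rw [length_flatten_replicate, length_take, min_eq_left hdl, Nat.div_mul_cancel hdvd]
  · rw [periodicSeq_flatten_replicate _ (Nat.div_pos hdl hd).ne', periodicSeq_take hd hdl h]

end List

/-! ### Prime lists and the Euler product -/

/-- A property of nonempty lists that is invariant under cyclic permutation and under passing to
and from repetitions. -/
structure CyclicProperty {α : Type*} (C : List α → Prop) : Prop where
  ne_nil : ∀ l, C l → l ≠ []
  rotate : ∀ l k, C l → C (l.rotate k)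
  repeat_iff : ∀ b m, m ≠ 0 → (C (List.replicate m b).flatten ↔ C b)

/-- The lists with property `C` that are not proper repetitions of lists with property `C`. -/
def IsPrimeFor {α : Type*} (C : List α → Prop) (c : List α) : Prop :=
  C c ∧ ¬ ∃ (b : List α) (m : ℕ), C b ∧ 2 ≤ m ∧ c = (List.replicate m b).flatten

namespace CyclicProperty

variable {α : Type*} {C : List α → Prop} (hC : CyclicProperty C)
include hC

theorem length_pos {l : List α} (hl : C l) : 0 < l.length := List.length_pos_iff.mpr (hC.ne_nil l hl)

theorem minimalPeriod_pos {l : List α} (hl : C l) :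
    0 < Function.minimalPeriod List.seqShift l.periodicSeq :=
  l.isPeriodicPt_periodicSeq.minimalPeriod_pos (hC.length_pos hl)

theorem of_take {l : List α} {d : ℕ} (hl : C l) (hd : 0 < d) (hdvd : d ∣ l.length)
    (h : Function.IsPeriodicPt List.seqShift d l.periodicSeq) : C (l.take d) := by
  rw [List.eq_flatten_replicate_take hd (hC.ne_nil l hl) hdvd h] at hl
  rwa [hC.repeat_iff] at hl
  intro h0
  simp [h0] at hl
  exact hC.ne_nil _ hl rfl

/-- The minimal period divides the length, and `l` repeats its initial segment of that length. Hence
`l` is a proper repetition exactly when the period is smaller than the length. -/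
theorem isPrimeFor_iff {l : List α} (hl : C l) :
    IsPrimeFor C l ↔ Function.minimalPeriod List.seqShift l.periodicSeq = l.length := by
  have hpos := hC.length_pos hl
  have hmp := hC.minimalPeriod_pos hl
  have hdvd := l.isPeriodicPt_periodicSeq.minimalPeriod_dvd
  have hper := Function.isPeriodicPt_minimalPeriod List.seqShift l.periodicSeq
  constructor
  · rintro ⟨-, hno⟩
    by_contra hne
    refine hno ⟨_, _, hC.of_take hl hmp hdvd hper, ?_,
      List.eq_flatten_replicate_take hmp (hC.ne_nil l hl) hdvd hper⟩
    obtain ⟨e, he⟩ := hdvd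
    have : l.length / Function.minimalPeriod List.seqShift l.periodicSeq = e := by
      conv_lhs => rw [he]
      exact Nat.mul_div_cancel_left _ hmp
    rw [this]
    by_contra hlt
    have : e = 0 ∨ e = 1 := by omega
    rcases this with rfl | rfl
    · omega
    · omega
  · rintro h
    refine ⟨hl, ?_⟩
    rintro ⟨b, m, hb, hm, rfl⟩
    rw [List.periodicSeq_flatten_replicate _ (by omega), List.length_flatten_replicate] at h
    have hle := b.isPeriodicPt_periodicSeq.minimalPeriod_le (hC.length_pos hb)
    have hbpos := hC.length_pos hb
    rw [h] at hle
    nlinarith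

/-- The `(k+1)`-fold repetition of a prime list. -/
def repeatPrime (x : {l // IsPrimeFor C l} × ℕ) : {l // C l} :=
  ⟨(List.replicate (x.2 + 1) x.1.1).flatten,
    (hC.repeat_iff _ _ (Nat.succ_ne_zero _)).mpr x.1.2.1⟩

/-- The periodic sequence recovers the prime root: its length is the minimal period. The total
length then recovers the multiplicity. -/
theorem bijective_repeatPrime : Function.Bijective hC.repeatPrime := by
  constructor
  · rintro ⟨⟨l, hl⟩, k⟩ ⟨⟨l', hl'⟩, k'⟩ h
    have h : (List.replicate (k + 1) l).flatten = (List.replicate (k' + 1) l').flatten :=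
      congrArg Subtype.val h
    have hseq := congrArg List.periodicSeq h
    rw [List.periodicSeq_flatten_replicate _ (Nat.succ_ne_zero _),
      List.periodicSeq_flatten_replicate _ (Nat.succ_ne_zero _)] at hseq
    have hlen : l.length = l'.length := by
      rw [← (hC.isPrimeFor_iff hl.1).mp hl, ← (hC.isPrimeFor_iff hl'.1).mp hl', hseq]
    obtain rfl := List.eq_of_periodicSeq_eq hlen hseq
    have hlen := congrArg List.length h
    rw [List.length_flatten_replicate, List.length_flatten_replicate] at hlen
    have := Nat.eq_of_mul_eq_mul_right (hC.length_pos hl.1) hlen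
    obtain rfl : k = k' := by omega
    rfl
  · rintro ⟨l, hl⟩
    have hpos := hC.length_pos hl
    have hmp := hC.minimalPeriod_pos hl
    have hdvd := l.isPeriodicPt_periodicSeq.minimalPeriod_dvd
    have hper := Function.isPeriodicPt_minimalPeriod List.seqShift l.periodicSeq
    have hle := Nat.le_of_dvd hpos hdvd
    have hb := hC.of_take hl hmp hdvd hper
    refine ⟨⟨⟨_, (hC.isPrimeFor_iff hb).mpr ?_⟩,
      l.length / Function.minimalPeriod List.seqShift l.periodicSeq - 1⟩, Subtype.ext ?_⟩
    · rw [List.periodicSeq_take hmp hle hper, List.length_take, min_eq_left hle]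
    · refine Eq.trans ?_ (List.eq_flatten_replicate_take hmp (hC.ne_nil l hl) hdvd hper).symm
      simp only [repeatPrime]
      rw [Nat.sub_add_cancel (Nat.div_pos hle hmp)]

theorem isPrimeFor_rotate {l : List α} (hl : IsPrimeFor C l) (k : ℕ) :
    IsPrimeFor C (l.rotate k) := by
  have h := (hC.isPrimeFor_iff hl.1).mp hl
  rw [hC.isPrimeFor_iff (hC.rotate l k hl.1), List.periodicSeq_rotate, List.length_rotate,
    Function.minimalPeriod_apply_iterate, h]
  exact Function.mk_mem_periodicPts (hC.length_pos hl.1) l.isPeriodicPt_periodicSeq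

theorem bijective_rotate {l : List α} (hl : IsPrimeFor C l) :
    Function.Bijective (fun i : Fin l.length =>
      (⟨⟨l.rotate i, hC.isPrimeFor_rotate hl i⟩, by
        simp⟩ :
        {x : {l // IsPrimeFor C l} // (x.1 : Cycle α) = (l : Cycle α)})) := by
  constructor
  · intro i j h
    have h : l.rotate i = l.rotate j := congrArg (fun x => x.1.1) h
    have hseq := congrArg List.periodicSeq h
    rw [List.periodicSeq_rotate, List.periodicSeq_rotate] at hseq
    have hmp := (hC.isPrimeFor_iff hl.1).mp hl
    exact Fin.ext (Function.iterate_injOn_Iio_minimalPeriod (by simp [hmp]) (by simp [hmp]) hseq)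
  · rintro ⟨⟨l', hl'⟩, h⟩
    obtain ⟨k, hk⟩ := (Cycle.coe_eq_coe.mp h).symm
    refine ⟨⟨k % l.length, Nat.mod_lt _ (hC.length_pos hl.1)⟩, ?_⟩
    refine Subtype.ext (Subtype.ext ?_)
    simpa using hk

/-- Summation in two stages: the repetitions of a prime list of length `m` contribute `-log(1 - u^m)
/ m`, and the `m` rotations in its class cancel the denominator. Exponentiating the resulting sum
gives unconditional convergence of the product. -/
theorem hasProd_eulerFactor {u : ℂ} (hu : ‖u‖ < 1) {S : ℂ}
    (hS : HasSum (fun c : {l // C l} => u ^ c.1.length / c.1.length) S) :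
    HasProd (fun p : {p : Cycle α | ∃ c, IsPrimeFor C c ∧ p = (c : Cycle α)} =>
      (1 - u ^ p.1.length)⁻¹) (Complex.exp S) := by
  have hlt : ∀ l : List α, C l → ‖u ^ l.length‖ < 1 := fun l hl => by
    rw [norm_pow]
    exact pow_lt_one₀ (norm_nonneg u) hu (hC.length_pos hl).ne'
  have h1 := (Equiv.ofBijective _ hC.bijective_repeatPrime).hasSum_iff.mpr hS
  have h2 : HasSum (fun x : {l // IsPrimeFor C l} =>
      -Complex.log (1 - u ^ x.1.length) / x.1.length) S := by
    refine h1.prod_fiberwise fun x => ?_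
    refine ((Complex.hasSum_taylorSeries_neg_log' (hlt _ x.2.1)).div_const
      (x.1.length : ℂ)).congr_fun fun k => ?_
    simp only [Function.comp_apply, Equiv.ofBijective_apply, repeatPrime,
      List.length_flatten_replicate]
    rw [← pow_mul, div_div, mul_comm x.1.length]
    push_cast
    rfl
  let φ : {l // IsPrimeFor C l} → {p : Cycle α | ∃ c, IsPrimeFor C c ∧ p = (c : Cycle α)} :=
    fun x => ⟨x.1, x.1, x.2, rfl⟩
  have h3 := (Equiv.sigmaFiberEquiv φ).hasSum_iff.mpr h2
  have h4 : HasSum (fun p : {p : Cycle α | ∃ c, IsPrimeFor C c ∧ p = (c : Cycle α)} =>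
      -Complex.log (1 - u ^ p.1.length)) S := by
    refine h3.sigma fun p => ?_
    obtain ⟨p, l, hl, rfl⟩ := p
    have hlen : (l.length : ℂ) ≠ 0 := Nat.cast_ne_zero.mpr (hC.length_pos hl.1).ne'
    let e : {x : {l // IsPrimeFor C l} // (x.1 : Cycle α) = (l : Cycle α)} ≃
        {x // φ x = ⟨(l : Cycle α), l, hl, rfl⟩} :=
      Equiv.subtypeEquivRight fun x => ⟨fun h => Subtype.ext h, fun h => congrArg Subtype.val h⟩
    rw [← ((Equiv.ofBijective _ (hC.bijective_rotate hl)).trans e).hasSum_iff]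
    convert hasSum_fintype
      (fun _ : Fin l.length => -Complex.log (1 - u ^ l.length) / (l.length : ℂ)) using 1
    · funext i
      simp [e, Equiv.sigmaFiberEquiv]
    · simp only [Finset.sum_const, Finset.card_univ, Fintype.card_fin, Cycle.length_coe,
        nsmul_eq_mul]
      field_simp
  refine h4.cexp.congr_fun fun p => ?_
  obtain ⟨p, l, hl, rfl⟩ := p
  rw [Function.comp_apply, Complex.exp_neg, Complex.exp_log]
  intro h
  have := hlt l hl.1
  rw [Cycle.length_coe] at h
  rw [← sub_eq_zero.mp h] at this
  simp at this

end CyclicProperty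

/-! ### Closed chains of a relation -/

/-- Nonempty lists whose cyclically consecutive entries are related by `R`. -/
def IsClosedChain {α : Type*} (R : α → α → Prop) (l : List α) : Prop :=
  l ≠ [] ∧ Cycle.Chain R (l : Cycle α)

theorem Cycle.chain_coe_iff_periodicSeq {α : Type*} (R : α → α → Prop) (l : List α) :
    Cycle.Chain R (l : Cycle α) ↔
      ∀ i a b, l.periodicSeq i = some a → l.periodicSeq (i + 1) = some b → R a b := by
  rcases l with - | ⟨x, t⟩
  · simp [List.periodicSeq]
  -- The closing copy of `x` sits at index `length`, where the periodic sequence has wrapped around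
  -- to `0`; hence `≤` rather than `<`.
  have key : ∀ i, i ≤ (x :: t).length → (x :: (t ++ [x]))[i]? = (x :: t).periodicSeq i := by
    intro i hi
    rw [← List.cons_append, List.periodicSeq]
    rcases hi.lt_or_eq with h | rfl
    · rw [List.getElem?_append_left h, Nat.mod_eq_of_lt h]
    · simp
  rw [Cycle.chain_coe_cons, List.isChain_iff_getElem]
  constructor
  · intro h i a b ha hb
    have hlt := Nat.mod_lt i (show 0 < (x :: t).length by simp)
    have h1 := key (i % (x :: t).length) hlt.le
    have h2 := key (i % (x :: t).length + 1) hlt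
    have e1 : (x :: t).periodicSeq (i % (x :: t).length) = (x :: t).periodicSeq i := by
      simp only [List.periodicSeq, Nat.mod_mod]
    have e2 : (x :: t).periodicSeq (i % (x :: t).length + 1) = (x :: t).periodicSeq (i + 1) := by
      simp only [List.periodicSeq, Nat.mod_add_mod]
    rw [e1, ha] at h1
    rw [e2, hb] at h2
    obtain ⟨p1, h1⟩ := List.getElem?_eq_some_iff.mp h1
    obtain ⟨p2, h2⟩ := List.getElem?_eq_some_iff.mp h2
    have := h (i % (x :: t).length) p2
    rwa [h1, h2] at this
  · intro h i hi
    have hi' : i + 1 ≤ (x :: t).length := by simp at hi ⊢; omega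
    refine h i _ _ ?_ ?_
    · rw [← key i (by omega), List.getElem?_eq_getElem]
    · rw [← key (i + 1) hi', List.getElem?_eq_getElem]

theorem cyclicProperty_isClosedChain {α : Type*} (R : α → α → Prop) :
    CyclicProperty (IsClosedChain R) where
  ne_nil l h := h.1
  rotate l k h := by
    refine ⟨by simpa using h.1, ?_⟩
    have : ((l.rotate k : List α) : Cycle α) = l := by simp
    rw [this]
    exact h.2
  repeat_iff b m hm := by
    unfold IsClosedChain
    rw [Cycle.chain_coe_iff_periodicSeq, Cycle.chain_coe_iff_periodicSeq,
      List.periodicSeq_flatten_replicate _ hm]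
    refine and_congr_left fun _ => not_congr ?_
    rw [← List.length_eq_zero_iff, ← List.length_eq_zero_iff, List.length_flatten_replicate]
    simp [hm]

/-! ### Counting closed chains by traces -/

section Trace

open scoped Classical in
/-- The `0`-`1` matrix of a relation. -/
noncomputable def Matrix.ofRel {X : Type*} (R : X → X → Prop) : Matrix X X ℂ :=
  Matrix.of fun i j => if R i j then 1 else 0

variable {X : Type*} [Fintype X] [DecidableEq X] (R : X → X → Prop)

open scoped Classical in
theorem Matrix.ofRel_pow_succ_apply (k : ℕ) (i j : X) :
    (Matrix.ofRel R ^ (k + 1)) i j =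
      ∑ f : Fin k → X, if List.IsChain R (i :: (List.ofFn f ++ [j])) then (1 : ℂ) else 0 := by
  induction k generalizing i with
  | zero => simp [Matrix.ofRel]
  | succ k ih =>
    rw [pow_succ', Matrix.mul_apply, ← (Fin.consEquiv fun _ => X).sum_comp, Fintype.sum_prod_type]
    refine Finset.sum_congr rfl fun a _ => ?_
    rw [ih a, Finset.mul_sum]
    refine Finset.sum_congr rfl fun f _ => ?_
    have : List.IsChain R (i :: (List.ofFn ((Fin.consEquiv fun _ => X) (a, f)) ++ [j])) ↔
        R i a ∧ List.IsChain R (a :: (List.ofFn f ++ [j])) := by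
      simp [Fin.consEquiv, List.ofFn_succ]
    simp only [this, Matrix.ofRel, Matrix.of_apply]
    split_ifs <;> simp_all

open scoped Classical in
theorem Matrix.trace_ofRel_pow_succ (k : ℕ) :
    (Matrix.ofRel R ^ (k + 1)).trace =
      ((Finset.univ.filter fun f : Fin (k + 1) → X => IsClosedChain R (List.ofFn f)).card : ℂ) := by
  rw [Finset.card_filter, Nat.cast_sum, ← (Fin.consEquiv fun _ => X).sum_comp,
    Fintype.sum_prod_type, Matrix.trace]
  refine Finset.sum_congr rfl fun a _ => ?_
  rw [Matrix.diag_apply, Matrix.ofRel_pow_succ_apply]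
  refine Finset.sum_congr rfl fun f _ => ?_
  simp [IsClosedChain, Fin.consEquiv, List.ofFn_succ]

/-- Grouping closed chains by length turns the sum into the trace series of the matrix of `R`. -/
theorem exists_hasSum_isClosedChain : ∃ r : ℝ, 0 < r ∧ ∀ u : ℂ, ‖u‖ < r → ∃ S : ℂ,
    HasSum (fun c : {l : List X // IsClosedChain R l} => u ^ c.1.length / c.1.length) S ∧
      Complex.exp S = (1 - u • Matrix.ofRel R).det⁻¹ := by
  classical
  obtain ⟨r, hr, H⟩ := (Matrix.ofRel R).exists_hasSum_trace_pow_div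
  refine ⟨r, hr, fun u hu => ?_⟩
  obtain ⟨S, hS, hexp⟩ := H u hu
  refine ⟨S, ?_, hexp⟩
  let N : ℕ → ℕ := fun m =>
    (Finset.univ.filter fun f : Fin m → X => IsClosedChain R (List.ofFn f)).card
  -- The field `E` is general because the count is needed over `ℂ` for the value and over `ℝ` for
  -- absolute convergence.
  have hfiber : ∀ {E : Type} [NormedField E] (g : ℕ → E) (m : ℕ),
      HasSum (fun f : Fin m → X => {l | IsClosedChain R l}.indicator (fun l => g l.length)
        (List.ofFn f)) (N m * g m) := by
    intro E _ g m
    have h : (N m * g m : E) = ∑ f : Fin m → X,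
        {l | IsClosedChain R l}.indicator (fun l => g l.length) (List.ofFn f) := by
      simp [Set.indicator_apply, N, ← Finset.sum_filter]
    rw [h]
    exact hasSum_fintype _
  -- The trace series starts at length `1`; the added term at `m = 0` vanishes because `u ^ 0 / 0 =
  -- 0`.
  have htotal : HasSum (fun m => (N m : ℂ) * (u ^ m / m)) S := by
    have h := (hasSum_nat_add_iff (f := fun m => (N m : ℂ) * (u ^ m / m)) 1 (g := S)).mp ?_
    · simpa using h
    · refine hS.congr_fun fun k => ?_
      rw [Matrix.trace_ofRel_pow_succ, ← mul_div_assoc]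
      push_cast
      rfl
  -- The counts are nonnegative, so the trace series at the point `‖u‖` of the same disc is the
  -- series of absolute values.
  have habs : Summable fun m => (N m : ℝ) * (‖u‖ ^ m / m) := by
    obtain ⟨S', hS', -⟩ := H (‖u‖ : ℂ) (by simpa using hu)
    refine (summable_nat_add_iff 1).mp (Complex.summable_ofReal.mp ?_)
    refine hS'.summable.congr fun k => ?_
    rw [Matrix.trace_ofRel_pow_succ, ← mul_div_assoc]
    push_cast
    rfl
  have hind : HasSum ({l | IsClosedChain R l}.indicator fun l : List X => u ^ l.length / l.length)
      S := by
    rw [← (List.equivSigmaTuple (α := X)).symm.hasSum_iff]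
    refine HasSum.sigma_of_hasSum htotal (fun m => hfiber (fun m => u ^ m / (m : ℂ)) m) ?_
    refine Summable.of_norm ?_
    have heq : (fun x => ‖(({l | IsClosedChain R l}.indicator fun l : List X =>
        u ^ l.length / (l.length : ℂ)) ∘ (List.equivSigmaTuple (α := X)).symm) x‖) =
        fun x : Σ n, Fin n → X => {l | IsClosedChain R l}.indicator
          (fun l => ‖u‖ ^ l.length / (l.length : ℝ)) (List.ofFn x.2) := by
      funext x
      rw [Function.comp_apply, norm_indicator_eq_indicator_norm]
      simp
    rw [heq]
    refine (summable_sigma_of_nonneg fun x => Set.indicator_nonneg (fun _ _ => by positivity) _).mpr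
      ⟨fun m => (hfiber (fun m => ‖u‖ ^ m / (m : ℝ)) m).summable, ?_⟩
    refine habs.congr fun m => ?_
    rw [← (hfiber (fun m => ‖u‖ ^ m / (m : ℝ)) m).tsum_eq]
  exact hasSum_subtype_iff_indicator.mpr hind

end Trace

/-! ### Bass's determinant formula -/

noncomputable section

namespace Matrix

/-- The permutation moving a vertex in direction `i`, forwards or backwards. -/
def dirStep {V I : Type*} (σ : I → Equiv.Perm V) (s : I × Bool) : Equiv.Perm V :=
  if s.2 then σ s.1 else (σ s.1).symm

/-- The opposite direction. -/
def dirFlip {I : Type*} (s : I × Bool) : I × Bool := (s.1, !s.2)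

@[simp]
theorem dirFlip_dirFlip {I : Type*} (s : I × Bool) : dirFlip (dirFlip s) = s := by
  simp [dirFlip]

@[simp]
theorem dirStep_dirFlip {V I : Type*} (σ : I → Equiv.Perm V) (s : I × Bool) :
    dirStep σ (dirFlip s) = (dirStep σ s).symm := by
  rcases s with ⟨i, b⟩
  cases b <;> simp [dirFlip, dirStep]

/-- Consecutive oriented edges of a reduced path: `(v, s)` is the oriented edge which ends at `v`
and points in direction `s`. -/
def EdgeRel {V I : Type*} (σ : I → Equiv.Perm V) (a b : V × (I × Bool)) : Prop :=
  b.1 = dirStep σ b.2 a.1 ∧ b.2 ≠ dirFlip a.2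

/-- The involution reversing oriented edges. -/
def edgeReverse {V I : Type*} (σ : I → Equiv.Perm V) : Equiv.Perm (V × (I × Bool)) where
  toFun a := (dirStep σ (dirFlip a.2) a.1, dirFlip a.2)
  invFun a := (dirStep σ (dirFlip a.2) a.1, dirFlip a.2)
  left_inv a := by simp
  right_inv a := by simp

variable {V I : Type*} [Fintype V] [DecidableEq V] [Fintype I] [DecidableEq I]
  (σ : I → Equiv.Perm V)

/-- The adjacency matrix. -/
def dirAdj : Matrix V V ℂ := of fun v w => ∑ s : I × Bool, if w = dirStep σ s v then 1 else 0

/-- The matrix of the edge reversal. -/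
def edgeReverseMatrix : Matrix (V × (I × Bool)) (V × (I × Bool)) ℂ :=
  of fun a b => if b = edgeReverse σ a then 1 else 0

/-- The incidence of oriented edges with their end points. -/
def edgeEnd (V I : Type*) [DecidableEq V] : Matrix (V × (I × Bool)) V ℂ :=
  of fun a v => if v = a.1 then 1 else 0

/-- The incidence of starting points with oriented edges. -/
def edgeStart : Matrix V (V × (I × Bool)) ℂ :=
  of fun v a => if a.1 = dirStep σ a.2 v then 1 else 0

-- All continuations of an oriented edge, minus the one that turns back.
omit [Fintype I] in
theorem ofRel_edgeRel_eq :
    ofRel (EdgeRel σ) = edgeEnd V I * edgeStart σ - edgeReverseMatrix σ := by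
  ext ⟨v, s⟩ ⟨w, t⟩
  have h1 : (edgeEnd V I * edgeStart σ) (v, s) (w, t) = if w = dirStep σ t v then 1 else 0 := by
    simp only [mul_apply, edgeEnd, edgeStart, of_apply, ite_mul, one_mul, zero_mul, Finset.sum_ite_eq',
      Finset.mem_univ, if_true]
  rw [sub_apply, h1]
  simp only [ofRel, EdgeRel, edgeReverseMatrix, of_apply, edgeReverse, Equiv.coe_fn_mk,
    Prod.mk.injEq]
  by_cases ht : t = dirFlip s
  · subst ht
    simp
  · simp [ht]

theorem edgeReverseMatrix_mul_self : edgeReverseMatrix σ * edgeReverseMatrix σ = 1 := by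
  ext a b
  have h : edgeReverse σ (edgeReverse σ a) = a := (edgeReverse σ).left_inv a
  simp only [mul_apply, edgeReverseMatrix, of_apply, ite_mul, one_mul, zero_mul, Finset.sum_ite_eq',
    Finset.mem_univ, if_true, h, one_apply]
  simp [eq_comm]

omit [DecidableEq I] in
theorem edgeStart_mul_edgeEnd : edgeStart σ * edgeEnd V I = dirAdj σ := by
  ext v w
  simp only [mul_apply, edgeStart, edgeEnd, dirAdj, of_apply, Fintype.sum_prod_type_right]
  refine Finset.sum_congr rfl fun i _ => Finset.sum_congr rfl fun b _ => ?_
  simp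

/-- Leaving a vertex along an edge and returning by its reverse ends at the same vertex, in `2 |I|`
ways. -/
theorem edgeStart_mul_edgeReverseMatrix_mul_edgeEnd :
    edgeStart σ * (edgeReverseMatrix σ * edgeEnd V I) =
      (2 * Fintype.card I : ℂ) • (1 : Matrix V V ℂ) := by
  ext v w
  have h1 : ∀ a w, (edgeReverseMatrix σ * edgeEnd V I) a w =
      if w = (dirStep σ a.2).symm a.1 then 1 else 0 := by
    intro a w
    simp only [mul_apply, edgeReverseMatrix, edgeEnd, of_apply, ite_mul, one_mul, zero_mul, Finset.sum_ite_eq',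
      Finset.mem_univ, if_true]
    simp [edgeReverse]
  simp only [mul_apply, h1, edgeStart, of_apply, smul_apply, one_apply]
  rw [Fintype.sum_prod_type_right]
  simp only [ite_mul, one_mul, zero_mul, Finset.sum_ite_eq', Finset.mem_univ, if_true,
    Equiv.symm_apply_apply]
  by_cases h : w = v
  · subst h
    simp [mul_comm]
  · simp [h, Ne.symm h]

/-- Reversal exchanges forward and backward edges, so splitting by orientation leaves identity
diagonal blocks and a Schur complement `(1 - u²) • 1`. -/
theorem det_one_add_smul_edgeReverseMatrix (u : ℂ) :
    (1 + u • edgeReverseMatrix σ).det = (1 - u ^ 2) ^ (Fintype.card V * Fintype.card I) := by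
  let e : (V × I) ⊕ (V × I) ≃ V × (I × Bool) :=
    { toFun := Sum.elim (fun x => (x.1, x.2, true)) (fun x => (x.1, x.2, false))
      invFun := fun x => if x.2.2 then Sum.inl (x.1, x.2.1) else Sum.inr (x.1, x.2.1)
      left_inv := by rintro (x | x) <;> simp
      right_inv := by rintro ⟨v, i, b⟩; cases b <;> simp }
  let C : Bool → Matrix (V × I) (V × I) ℂ := fun b =>
    of fun x y => if y = (dirStep σ (x.2, b) x.1, x.2) then 1 else 0
  have hblock : (1 + u • edgeReverseMatrix σ).submatrix e e =
      fromBlocks 1 (u • C false) (u • C true) 1 := by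
    ext (⟨v, i⟩ | ⟨v, i⟩) (⟨w, j⟩ | ⟨w, j⟩) <;>
      simp [e, C, edgeReverseMatrix, edgeReverse, dirFlip, one_apply]
  have hmul : C true * C false = 1 := by
    ext ⟨v, i⟩ ⟨w, j⟩
    simp only [mul_apply, C, of_apply, ite_mul, one_mul, zero_mul, Finset.sum_ite_eq',
      Finset.mem_univ, if_true, one_apply, dirStep]
    simp [eq_comm]
  rw [← det_submatrix_equiv_self e, hblock, det_fromBlocks_one₁₁, Matrix.smul_mul, Matrix.mul_smul, hmul,
    smul_smul]
  have : (1 - (u * u) • 1 : Matrix (V × I) (V × I) ℂ) = (1 - u ^ 2) • 1 := by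
    rw [sub_smul, one_smul, pow_two]
  rw [this, det_smul, det_one, mul_one, Fintype.card_prod]

theorem det_smul_one_sub_mul_comm {m n : Type*} [Fintype m] [DecidableEq m] [Fintype n]
    [DecidableEq n] (A : Matrix m n ℂ) (B : Matrix n m ℂ) {c : ℂ} (hc : c ≠ 0) :
    c ^ Fintype.card n * (c • 1 - A * B).det = c ^ Fintype.card m * (c • 1 - B * A).det := by
  have h1 : c • 1 - A * B = c • (1 - (c⁻¹ • A) * B) := by
    rw [smul_sub, Matrix.smul_mul, smul_inv_smul₀ hc]
  have h2 : c • 1 - B * A = c • (1 - B * (c⁻¹ • A)) := by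
    rw [smul_sub, Matrix.mul_smul, smul_inv_smul₀ hc]
  rw [h1, h2, det_smul, det_smul, det_one_sub_mul_comm]
  ring

/-- With `W = T S - P` and `P² = 1` one has `(1 - uW)(1 - uP) = (1 - u²) - T · u S (1 - uP)`.
Exchanging the two factors of the last product under the determinant passes from edges to vertices,
where `S T = A` and `S P T = 2 |I|`. -/
theorem bass_formula {u : ℂ} (hu : 1 - u ^ 2 ≠ 0) :
    (1 - u ^ 2) ^ Fintype.card V * (1 - u • ofRel (EdgeRel σ)).det =
      (1 - u ^ 2) ^ (Fintype.card V * Fintype.card I) *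
        ((1 + (2 * Fintype.card I - 1) * u ^ 2) • 1 - u • dirAdj σ).det := by
  set P := edgeReverseMatrix σ with hPdef
  have h1 : (1 - u • ofRel (EdgeRel σ)) * (1 + (-u) • P) =
      (1 - u ^ 2) • 1 - edgeEnd V I * (u • (edgeStart σ * (1 + (-u) • P))) := by
    rw [ofRel_edgeRel_eq, ← hPdef]
    have hP : P * P = 1 := edgeReverseMatrix_mul_self σ
    simp only [Matrix.sub_mul, Matrix.mul_add, smul_sub, Matrix.smul_mul, Matrix.mul_smul,
      Matrix.mul_assoc, Matrix.one_mul, Matrix.mul_one, hP, smul_add, smul_smul]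
    module
  have h2 : (u • (edgeStart σ * (1 + (-u) • P))) * edgeEnd V I =
      u • dirAdj σ - (u ^ 2 * (2 * Fintype.card I)) • 1 := by
    rw [← edgeStart_mul_edgeEnd, SemigroupAction.mul_smul (u ^ 2),
      ← edgeStart_mul_edgeReverseMatrix_mul_edgeEnd]
    simp only [Matrix.mul_add, Matrix.smul_mul, Matrix.mul_smul, Matrix.mul_assoc, Matrix.mul_one,
      Matrix.add_mul]
    module
  have h3 := congrArg det h1
  rw [det_mul, det_one_add_smul_edgeReverseMatrix] at h3
  have h4 := det_smul_one_sub_mul_comm (edgeEnd V I) (u • (edgeStart σ * (1 + (-u) • P))) hu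
  rw [← h3, h2] at h4
  have h5 : (1 - u ^ 2) • (1 : Matrix V V ℂ) -
      (u • dirAdj σ - (u ^ 2 * (2 * Fintype.card I)) • 1) =
      (1 + (2 * Fintype.card I - 1) * u ^ 2) • 1 - u • dirAdj σ := by
    module
  rw [h5] at h4
  have hcard : Fintype.card (V × (I × Bool)) =
      Fintype.card V * Fintype.card I + Fintype.card V * Fintype.card I := by
    simp only [Fintype.card_prod, Fintype.card_bool]
    ring
  rw [hcard, pow_add, neg_sq] at h4
  refine mul_right_cancel₀ (pow_ne_zero (Fintype.card V * Fintype.card I) hu) ?_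
  linear_combination h4

end Matrix

end

/-! ### Diagonalization of the adjacency matrix by characters -/

section Spectrum

variable {ι : Type*} [Fintype ι] [DecidableEq ι] {n : ι → ℕ} [∀ i, NeZero (n i)]

/-- Translation by the `i`-th unit vector. -/
noncomputable def unitShift (n : ι → ℕ) (i : ι) : Equiv.Perm (∀ i, ZMod (n i)) :=
  Equiv.addRight (Pi.single i 1)

theorem ZMod.stdAddChar_add_neg_eq_cos {N : ℕ} [NeZero N] (k : ZMod N) :
    ZMod.stdAddChar k + ZMod.stdAddChar (-k) =
      ((2 * Real.cos (2 * Real.pi * k.val / N) : ℝ) : ℂ) := by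
  have h : ∀ j : ℤ, ZMod.stdAddChar (j : ZMod N) =
      Complex.exp ((j * (2 * Real.pi / N) : ℝ) * Complex.I) := by
    intro j
    rw [ZMod.stdAddChar_coe]
    congr 1
    push_cast
    ring
  have h1 : ZMod.stdAddChar k = Complex.exp ((k.val * (2 * Real.pi / N) : ℝ) * Complex.I) := by
    have := h k.val
    simpa using this
  have h2 : ZMod.stdAddChar (-k) =
      Complex.exp ((-k.val * (2 * Real.pi / N) : ℝ) * Complex.I) := by
    have := h (-k.val)
    simpa using this
  rw [h1, h2]
  push_cast
  rw [Complex.cos, mul_div_cancel₀ _ (two_ne_zero)]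
  congr 2 <;> ring

/-- The matrix of the finite Fourier transform. -/
noncomputable def fourierMatrix (n : ι → ℕ) [∀ i, NeZero (n i)] :
    Matrix (∀ i, ZMod (n i)) (∀ i, ZMod (n i)) ℂ :=
  Matrix.of fun v k => ∏ i, ZMod.stdAddChar (v i * k i)

/-- Orthogonality of characters; it serves to show that the Fourier matrix is invertible. -/
theorem fourierMatrix_mul_conj : fourierMatrix n *
    (Matrix.of fun k w => ∏ i, ZMod.stdAddChar (-(k i * w i))) =
      ((∏ i, n i : ℕ) : ℂ) • 1 := by
  ext v w
  have h : ∀ k : ∀ i, ZMod (n i), (∏ i, ZMod.stdAddChar (v i * k i)) *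
      ∏ i, ZMod.stdAddChar (-(k i * w i)) =
        ∏ i, (ZMod.stdAddChar (k i * (v i - w i)) : ℂ) := by
    intro k
    rw [← Finset.prod_mul_distrib]
    refine Finset.prod_congr rfl fun i _ => ?_
    rw [← AddChar.map_add_eq_mul]
    congr 1
    ring
  simp only [Matrix.mul_apply, fourierMatrix, Matrix.of_apply, h]
  rw [← Fintype.prod_sum (fun i (a : ZMod (n i)) => (ZMod.stdAddChar (a * (v i - w i)) : ℂ))]
  simp only [AddChar.sum_mulShift _ (ZMod.isPrimitive_stdAddChar _), ZMod.card]
  rw [Matrix.smul_apply, Matrix.one_apply]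
  split_ifs with hvw
  · simp [hvw]
  · obtain ⟨i, hi⟩ := Function.ne_iff.mp hvw
    rw [Finset.prod_eq_zero (Finset.mem_univ i)]
    · simp
    · simp [sub_eq_zero, hi]

theorem dirAdj_mul_fourierMatrix :
    Matrix.dirAdj (unitShift n) * fourierMatrix n = fourierMatrix n *
      Matrix.diagonal fun k =>
        ((∑ i, 2 * Real.cos (2 * Real.pi * (k i).val / n i) : ℝ) : ℂ) := by
  ext v k
  have hstep : ∀ (i : ι) (c : ZMod (n i)),
      (∏ j, ZMod.stdAddChar ((v + Pi.single i c : ∀ i, ZMod (n i)) j * k j) : ℂ) =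
        (∏ j, ZMod.stdAddChar (v j * k j)) * ZMod.stdAddChar (c * k i) := by
    intro i c
    have : ∀ j, (ZMod.stdAddChar ((v + Pi.single i c : ∀ i, ZMod (n i)) j * k j) : ℂ) =
        ZMod.stdAddChar (v j * k j) *
          (ZMod.stdAddChar ((Pi.single i c : ∀ i, ZMod (n i)) j * k j) : ℂ) := by
      intro j
      rw [Pi.add_apply, add_mul, AddChar.map_add_eq_mul]
    simp only [this, Finset.prod_mul_distrib]
    congr 1
    rw [Finset.prod_eq_single i]
    · simp
    · intro j _ hj
      simp [Pi.single_eq_of_ne hj]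
    · simp
  have hneg : ∀ i, (unitShift n i).symm v = v + Pi.single i (-1) := by
    intro i
    simp [unitShift, Pi.single_neg]
  have hpos : ∀ i, unitShift n i v = v + Pi.single i 1 := by
    intro i
    simp [unitShift]
  rw [Matrix.mul_diagonal, Matrix.mul_apply]
  simp only [Matrix.dirAdj, Matrix.of_apply, Finset.sum_mul, ite_mul, one_mul, zero_mul]
  rw [Finset.sum_comm]
  simp only [Finset.sum_ite_eq', Finset.mem_univ, if_true]
  rw [Fintype.sum_prod_type]
  push_cast
  rw [Finset.mul_sum]
  refine Finset.sum_congr rfl fun i _ => ?_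
  have := ZMod.stdAddChar_add_neg_eq_cos (k i)
  push_cast at this
  rw [Fintype.sum_bool, ← this]
  simp only [Matrix.dirStep, if_true, Bool.false_eq_true, if_false, hneg, hpos, fourierMatrix,
    Matrix.of_apply, hstep]
  rw [mul_add]
  simp

theorem det_smul_one_sub_smul_dirAdj (x y : ℂ) :
    (x • 1 - y • Matrix.dirAdj (unitShift n)).det = ∏ k : ∀ i, ZMod (n i),
      (x - y * ((∑ i, 2 * Real.cos (2 * Real.pi * (k i).val / n i) : ℝ) : ℂ)) := by
  have hF : (fourierMatrix n).det ≠ 0 := by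
    intro h
    have h1 := congrArg Matrix.det (fourierMatrix_mul_conj (n := n))
    rw [Matrix.det_mul, h, zero_mul, Matrix.det_smul, Matrix.det_one, mul_one] at h1
    refine pow_ne_zero _ ?_ h1.symm
    exact_mod_cast Finset.prod_ne_zero_iff.mpr fun i _ => NeZero.ne (n i)
  have h : (x • 1 - y • Matrix.dirAdj (unitShift n)) * fourierMatrix n = fourierMatrix n *
      Matrix.diagonal fun k =>
        (x - y * ((∑ i, 2 * Real.cos (2 * Real.pi * (k i).val / n i) : ℝ) : ℂ)) := by
    rw [Matrix.sub_mul, Matrix.smul_mul, Matrix.smul_mul, dirAdj_mul_fourierMatrix,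
      ← Matrix.mul_smul, Matrix.one_mul]
    ext v k
    simp only [Matrix.sub_apply, Matrix.smul_apply, Matrix.mul_diagonal,
      smul_eq_mul]
    ring
  have h2 := congrArg Matrix.det h
  rw [Matrix.det_mul, Matrix.det_mul, Matrix.det_diagonal, mul_comm] at h2
  exact mul_left_cancel₀ hF h2

end Spectrum

/-! ### Grouping the eigenvalues by lowest terms -/

/-- The denominator of `k / n` in lowest terms. -/
def reducedDenom (n k : ℕ) : ℕ := n / n.gcd k

/-- A representative of the numerator of `k / n` in lowest terms, up to sign. -/
def reducedNum (n k : ℕ) : ℕ :=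
  if reducedDenom n k ≤ 2 then 1
  else min (k / n.gcd k) (reducedDenom n k - k / n.gcd k)

theorem exists_eq_mul_reducedDenom {n k : ℕ} (hk : k < n) :
    ∃ m a, 0 < m ∧ n = reducedDenom n k * m ∧ k = a * m ∧ a < reducedDenom n k ∧
      Nat.Coprime (reducedDenom n k) a ∧ k / n.gcd k = a := by
  have hn : 0 < n := by omega
  have hg : 0 < n.gcd k := Nat.gcd_pos_of_pos_left _ hn
  have h1 := Nat.div_mul_cancel (Nat.gcd_dvd_left n k)
  have h2 := Nat.div_mul_cancel (Nat.gcd_dvd_right n k)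
  refine ⟨n.gcd k, k / n.gcd k, hg, h1.symm, h2.symm, ?_, Nat.coprime_div_gcd_div_gcd hg, rfl⟩
  refine Nat.lt_of_mul_lt_mul_right (a := n.gcd k) ?_
  rw [reducedDenom, h1, h2]
  exact hk

theorem reducedDenom_mul {d m a : ℕ} (hm : 0 < m) (hda : Nat.Coprime d a) :
    reducedDenom (d * m) (a * m) = d := by
  rw [reducedDenom, Nat.gcd_mul_right, hda.gcd_eq_one, one_mul, Nat.mul_div_cancel _ hm]

theorem reducedNum_mul {d m a : ℕ} (hm : 0 < m) (hda : Nat.Coprime d a) :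
    reducedNum (d * m) (a * m) = if d ≤ 2 then 1 else min a (d - a) := by
  rw [reducedNum, reducedDenom_mul hm hda, Nat.gcd_mul_right, hda.gcd_eq_one, one_mul,
    Nat.mul_div_cancel _ hm]

namespace CubicalLattice

theorem mem_J_of_three_le {d j : ℕ} (hd : 3 ≤ d) : j ∈ J d ↔ 2 * j < d ∧ Nat.gcd j d = 1 := by
  rw [J, if_neg (by omega), Finset.mem_filter, Finset.mem_range]
  constructor
  · exact fun h => h.2
  · exact fun h => ⟨by omega, h⟩

theorem J_of_le_two {d : ℕ} (hd : d ≤ 2) : J d = {1} := by rw [J, if_pos hd]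

theorem reducedDenom_mem_divisors {n k : ℕ} (hk : k < n) : reducedDenom n k ∈ n.divisors := by
  obtain ⟨m, a, hm, hn, -⟩ := exists_eq_mul_reducedDenom hk
  exact Nat.mem_divisors.mpr ⟨Dvd.intro _ hn.symm, by omega⟩

theorem reducedNum_mem_J {n k : ℕ} (hk : k < n) : reducedNum n k ∈ J (reducedDenom n k) := by
  obtain ⟨m, a, hm, hn, hka, had, hcop, hdiv⟩ := exists_eq_mul_reducedDenom hk
  rw [reducedNum, hdiv]
  generalize reducedDenom n k = d at *
  split_ifs with h
  · simp [J_of_le_two h]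
  · rw [mem_J_of_three_le (by omega)]
    have h2 : ¬ (2 * a = d) := by
      rintro rfl
      have : a ∣ 1 := by
        rw [← hcop.gcd_eq_one]
        exact Nat.dvd_gcd (Dvd.intro_left _ rfl) dvd_rfl
      have := Nat.dvd_one.mp this
      omega
    rcases le_total a (d - a) with h3 | h3
    · rw [min_eq_left h3]
      exact ⟨by omega, hcop.symm⟩
    · rw [min_eq_right h3]
      refine ⟨by omega, ?_⟩
      rw [Nat.gcd_comm, Nat.gcd_self_sub_right had.le]
      exact hcop

/-- Cosine does not separate `a/d` from `(d - a)/d`. For `d = 1` the representative is `1` instead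
of `0`, which shifts the angle by a full turn. -/
theorem cos_reducedNum {n k : ℕ} (hk : k < n) :
    Real.cos (2 * Real.pi * (reducedNum n k : ℝ) / (reducedDenom n k : ℝ)) =
      Real.cos (2 * Real.pi * (k : ℝ) / (n : ℝ)) := by
  obtain ⟨m, a, hm, hn, hka, had, hcop, hdiv⟩ := exists_eq_mul_reducedDenom hk
  rw [reducedNum, hdiv]
  generalize reducedDenom n k = d at *
  subst hn hka
  have hm' : (m : ℝ) ≠ 0 := by positivity
  have hd' : (d : ℝ) ≠ 0 := by
    have : d ≠ 0 := by omega
    positivity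
  have e : 2 * Real.pi * ((a * m : ℕ) : ℝ) / ((d * m : ℕ) : ℝ) = 2 * Real.pi * a / d := by
    push_cast
    field_simp
  rw [e]
  split_ifs with h
  · have : d = 1 ∨ d = 2 := by omega
    rcases this with rfl | rfl
    · obtain rfl : a = 0 := by omega
      simp
    · obtain rfl : a = 1 := by
        rcases (by omega : a = 0 ∨ a = 1) with rfl | rfl
        · simp at hcop
        · rfl
      simp
  · rcases le_total a (d - a) with h3 | h3
    · rw [min_eq_left h3]
    · rw [min_eq_right h3, Nat.cast_sub had.le]
      have : 2 * Real.pi * ((d : ℝ) - a) / d = 2 * Real.pi - 2 * Real.pi * a / d := by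
        field_simp
      rw [this, Real.cos_two_pi_sub]

/-- With `n = d m`, the solutions are `j m` and `(d - j) m`, distinct as `2 j < d`. For `d ≤ 2` they
collapse to the single value `(d - 1) m`. -/
theorem card_filter_reduced {n d j : ℕ} (hn : 0 < n) (hd : d ∈ n.divisors) (hj : j ∈ J d) :
    ((Finset.range n).filter fun k => reducedDenom n k = d ∧ reducedNum n k = j).card =
      if 3 ≤ d then 2 else 1 := by
  obtain ⟨m, rfl⟩ := (Nat.mem_divisors.mp hd).1
  have hd0 : 0 < d := Nat.pos_of_mul_pos_right hn
  have hm0 : 0 < m := Nat.pos_of_mul_pos_left hn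
  split_ifs with h3
  · rw [mem_J_of_three_le h3] at hj
    have hcop : Nat.Coprime d j := Nat.Coprime.symm hj.2
    have hcop' : Nat.Coprime d (d - j) := by
      rw [Nat.Coprime, Nat.gcd_self_sub_right (by omega)]
      exact hcop
    have : ((Finset.range (d * m)).filter fun k =>
        reducedDenom (d * m) k = d ∧ reducedNum (d * m) k = j) = {j * m, (d - j) * m} := by
      ext k
      simp only [Finset.mem_filter, Finset.mem_range, Finset.mem_insert, Finset.mem_singleton]
      constructor
      · rintro ⟨hk, h1, h2⟩
        obtain ⟨m', a, hm, hn, hka, had, hc, hdiv⟩ := exists_eq_mul_reducedDenom hk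
        rw [reducedNum, hdiv, h1, if_neg (by omega)] at h2
        rw [h1] at hn had
        obtain rfl := Nat.eq_of_mul_eq_mul_left hd0 hn
        rcases le_total a (d - a) with h | h
        · rw [min_eq_left h] at h2
          exact Or.inl (by rw [hka, h2])
        · rw [min_eq_right h] at h2
          exact Or.inr (by rw [hka, ← h2, Nat.sub_sub_self had.le])
      · rintro (rfl | rfl)
        · refine ⟨Nat.mul_lt_mul_of_pos_right (by omega) hm0, reducedDenom_mul hm0 hcop, ?_⟩
          rw [reducedNum_mul hm0 hcop, if_neg (by omega)]
          omega
        · have : j ≠ 0 := by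
            rintro rfl
            simp at hj
            omega
          refine ⟨Nat.mul_lt_mul_of_pos_right (by omega) hm0, reducedDenom_mul hm0 hcop', ?_⟩
          rw [reducedNum_mul hm0 hcop', if_neg (by omega)]
          omega
    rw [this, Finset.card_pair]
    intro h
    have := Nat.eq_of_mul_eq_mul_right hm0 h
    omega
  · have h2 : d ≤ 2 := by omega
    rw [J_of_le_two h2, Finset.mem_singleton] at hj
    subst hj
    have hcop : Nat.Coprime d (d - 1) := by
      rcases (by omega : d = 1 ∨ d = 2) with rfl | rfl <;> simp
    have : ((Finset.range (d * m)).filter fun k =>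
        reducedDenom (d * m) k = d ∧ reducedNum (d * m) k = 1) = {(d - 1) * m} := by
      ext k
      simp only [Finset.mem_filter, Finset.mem_range, Finset.mem_singleton]
      constructor
      · rintro ⟨hk, h1, -⟩
        obtain ⟨m', a, hm, hn, hka, had, hc, hdiv⟩ := exists_eq_mul_reducedDenom hk
        rw [h1] at hn had hc
        obtain rfl := Nat.eq_of_mul_eq_mul_left hd0 hn
        have : a = d - 1 := by
          rcases (by omega : d = 1 ∨ d = 2) with rfl | rfl
          · omega
          · rcases (by omega : a = 0 ∨ a = 1) with rfl | rfl
            · simp at hc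
            · rfl
        rw [hka, this]
      · rintro rfl
        refine ⟨Nat.mul_lt_mul_of_pos_right (by omega) hm0, reducedDenom_mul hm0 hcop, ?_⟩
        rw [reducedNum_mul hm0 hcop, if_pos h2]
    rw [this, Finset.card_singleton]

/-- The factor depends only on the vectors of reduced denominators and numerators. Each pair `(d,
j)` has a fibre that is a product of sets of size `2` or `1`, of total size `eps d`. -/
theorem prod_cos_eq_prod_divisors {q : ℕ} (n : Fin q → ℕ) (hn : ∀ i, 0 < n i)
    (F : (Fin q → ℝ) → ℂ) :
    ∏ k ∈ Fintype.piFinset (fun i => Finset.range (n i)),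
        F (fun i => Real.cos (2 * Real.pi * (k i : ℝ) / (n i : ℝ))) =
      ∏ d ∈ Fintype.piFinset (fun i => (n i).divisors),
        (∏ j ∈ Fintype.piFinset (fun i => J (d i)),
          F (fun i => Real.cos (2 * Real.pi * (j i : ℝ) / (d i : ℝ)))) ^ eps d := by
  have hmem : ∀ k : Fin q → ℕ, k ∈ Fintype.piFinset (fun i => Finset.range (n i)) →
      ∀ i, k i < n i := fun k hk i => Finset.mem_range.mp (Fintype.mem_piFinset.mp hk i)
  rw [← Finset.prod_fiberwise_of_maps_to (s := Fintype.piFinset fun i => Finset.range (n i))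
    (t := Fintype.piFinset fun i => (n i).divisors)
    (g := fun k i => reducedDenom (n i) (k i))
    (fun k hk => Fintype.mem_piFinset.mpr fun i => reducedDenom_mem_divisors (hmem k hk i))]
  refine Finset.prod_congr rfl fun d hd => ?_
  rw [← Finset.prod_fiberwise_of_maps_to
    (t := Fintype.piFinset fun i => J (d i)) (g := fun k i => reducedNum (n i) (k i)),
    ← Finset.prod_pow]
  · refine Finset.prod_congr rfl fun j hj => ?_
    rw [Finset.prod_congr rfl (g := fun _ =>
      F (fun i => Real.cos (2 * Real.pi * (j i : ℝ) / (d i : ℝ)))), Finset.prod_const]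
    · congr 1
      have : Finset.filter (fun k => (fun i => reducedNum (n i) (k i)) = j)
          (Finset.filter (fun k => (fun i => reducedDenom (n i) (k i)) = d)
            (Fintype.piFinset fun i => Finset.range (n i))) =
          Fintype.piFinset fun i => (Finset.range (n i)).filter fun k =>
            reducedDenom (n i) k = d i ∧ reducedNum (n i) k = j i := by
        ext k
        simp only [Finset.mem_filter, Fintype.mem_piFinset, funext_iff, forall_and]
        tauto
      rw [this, Fintype.card_piFinset, eps]
      rw [Finset.prod_congr rfl fun i _ => card_filter_reduced (hn i)
        (Fintype.mem_piFinset.mp hd i) (Fintype.mem_piFinset.mp hj i)]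
      simp [Finset.prod_ite]
    · intro k hk
      rw [Finset.mem_filter, Finset.mem_filter] at hk
      obtain ⟨⟨hk, rfl⟩, rfl⟩ := hk
      congr 1
      funext i
      exact (cos_reducedNum (hmem k hk i)).symm
  · intro k hk
    rw [Finset.mem_filter] at hk
    obtain ⟨hk, rfl⟩ := hk
    exact Fintype.mem_piFinset.mpr fun i => reducedNum_mem_J (hmem k hk i)

theorem prod_zmod_val {q : ℕ} (n : Fin q → ℕ) [∀ i, NeZero (n i)] (F : (Fin q → ℕ) → ℂ) :
    ∏ k : ∀ i, ZMod (n i), F (fun i => (k i).val) =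
      ∏ k ∈ Fintype.piFinset (fun i => Finset.range (n i)), F k := by
  refine Finset.prod_bij' (fun k _ i => (k i).val) (fun k _ i => (k i : ZMod (n i))) ?_ ?_ ?_ ?_ ?_
  · intro k _
    simp [ZMod.val_lt]
  · simp
  · intro k _
    funext i
    simp
  · intro k hk
    funext i
    exact ZMod.val_cast_of_lt (Finset.mem_range.mp (Fintype.mem_piFinset.mp hk i))
  · simp

theorem det_smul_one_sub_dirAdj_eq_prod_Psi {q : ℕ} (n : Fin q → ℕ) [∀ i, NeZero (n i)]
    (x y : ℂ) :
    (x • 1 - y • Matrix.dirAdj (unitShift n)).det =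
      ∏ d ∈ Fintype.piFinset (fun i => (n i).divisors),
        (MvPolynomial.aeval ![x, y] (Psi d)) ^ eps d := by
  rw [det_smul_one_sub_smul_dirAdj,
    prod_zmod_val n fun k =>
      x - y * ((∑ i, 2 * Real.cos (2 * Real.pi * (k i : ℝ) / (n i : ℝ)) : ℝ) : ℂ),
    prod_cos_eq_prod_divisors n (fun i => Nat.pos_of_neZero (n i)) fun c =>
      x - y * ((∑ i, 2 * c i : ℝ) : ℂ)]
  refine Finset.prod_congr rfl fun d _ => ?_
  congr 1
  rw [Psi, map_prod]
  refine Finset.prod_congr rfl fun j _ => ?_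
  simp only [map_sub, map_mul, MvPolynomial.aeval_X, MvPolynomial.aeval_C, Matrix.cons_val_zero,
    Matrix.cons_val_one, Finset.mul_sum, Complex.coe_algebraMap]
  ring

end CubicalLattice

/-! ### Intervals, cubes and their incidences -/

namespace CubicalLattice

section Intervals

theorem coe_mem_interval_iff {m : ℕ} {a b t : ℝ} :
    (t : AddCircle (m : ℝ)) ∈ interval m a b ↔ ∃ z : ℤ, a ≤ t - z * m ∧ t - z * m ≤ b := by
  constructor
  · rintro ⟨y, ⟨h1, h2⟩, hy⟩
    have h0 : ((t - y : ℝ) : AddCircle (m : ℝ)) = 0 := by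
      rw [AddCircle.coe_sub, sub_eq_zero]
      exact hy.symm
    obtain ⟨z, hz⟩ := AddCircle.coe_eq_zero_iff _ |>.mp h0
    rw [zsmul_eq_mul] at hz
    have : t - z * m = y := by linarith
    exact ⟨z, by rwa [this], by rwa [this]⟩
  · rintro ⟨z, h1, h2⟩
    refine ⟨t - z * m, ⟨h1, h2⟩, ?_⟩
    have h0 : (((z * m : ℝ)) : AddCircle (m : ℝ)) = 0 :=
      AddCircle.coe_eq_zero_iff _ |>.mpr ⟨z, by simp⟩
    simp only [AddCircle.coe_sub, h0, sub_zero]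

variable {m : ℕ} [NeZero m]

/-- The degenerate interval at `v`. -/
def pointAt (v : ZMod m) : Set (AddCircle (m : ℝ)) := interval m (v.val : ℝ) (v.val : ℝ)

/-- The unit interval starting at `v`. -/
def unitAt (v : ZMod m) : Set (AddCircle (m : ℝ)) := interval m (v.val : ℝ) ((v.val : ℝ) + 1)

theorem mem_unitIntervals_iff {A : Set (AddCircle (m : ℝ))} :
    A ∈ unitIntervals m ↔ ∃ v : ZMod m, A = unitAt v := by
  constructor
  · rintro ⟨v, hv, rfl⟩
    exact ⟨v, by rw [unitAt, ZMod.val_cast_of_lt hv]⟩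
  · rintro ⟨v, rfl⟩
    exact ⟨v.val, v.val_lt, rfl⟩

theorem mem_pointIntervals_iff {A : Set (AddCircle (m : ℝ))} :
    A ∈ pointIntervals m ↔ ∃ v : ZMod m, A = pointAt v := by
  constructor
  · rintro ⟨v, hv, rfl⟩
    exact ⟨v, by rw [pointAt, ZMod.val_cast_of_lt hv]⟩
  · rintro ⟨v, rfl⟩
    exact ⟨v.val, v.val_lt, rfl⟩

omit [NeZero m] in
theorem pointAt_nonempty (v : ZMod m) : (pointAt v).Nonempty :=
  ⟨_, _, ⟨le_rfl, le_rfl⟩, rfl⟩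

omit [NeZero m] in
theorem unitAt_nonempty (v : ZMod m) : (unitAt v).Nonempty :=
  ⟨_, _, ⟨le_rfl, by linarith⟩, rfl⟩

theorem eq_add_natCast_of_val_sub {v w : ZMod m} {z : ℤ} {c : ℕ}
    (h : (v.val : ℤ) - z * m = w.val + c) : v = w + c := by
  have := congrArg (Int.cast : ℤ → ZMod m) h
  simpa using this

theorem exists_int_of_eq_add {v w : ZMod m} {c : ℕ} (h : v = w + c) :
    ∃ z : ℤ, (v.val : ℤ) - z * m = w.val + c := by
  have h1 : (((v.val : ℤ) - (w.val + c) : ℤ) : ZMod m) = 0 := by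
    push_cast
    simp [h]
  obtain ⟨z, hz⟩ := (ZMod.intCast_zmod_eq_zero_iff_dvd _ m).mp h1
  exact ⟨z, by linarith⟩

theorem unitAt_subset_unitAt_iff {v w : ZMod m} : unitAt v ⊆ unitAt w ↔ v = w := by
  refine ⟨fun h => ?_, fun h => h ▸ subset_rfl⟩
  -- The midpoint is tested because endpoints are shared by neighbouring intervals.
  have hmem : (((v.val : ℝ) + 1 / 2 : ℝ) : AddCircle (m : ℝ)) ∈ unitAt v :=
    ⟨_, ⟨by linarith, by linarith⟩, rfl⟩
  obtain ⟨z, h1, h2⟩ := coe_mem_interval_iff.mp (h hmem)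
  have e1 : (w.val : ℝ) < ((v.val : ℤ) - z * m + 1 : ℤ) := by push_cast; linarith
  have e2 : (((v.val : ℤ) - z * m : ℤ) : ℝ) < ((w.val : ℤ) + 1 : ℤ) := by push_cast; linarith
  have e1' : (w.val : ℤ) < (v.val : ℤ) - z * m + 1 := by exact_mod_cast e1
  have e2' := Int.cast_lt.mp e2
  simpa using eq_add_natCast_of_val_sub (v := v) (w := w) (z := z) (c := 0) (by push_cast; linarith)

theorem pointAt_subset_unitAt_iff {v w : ZMod m} : pointAt v ⊆ unitAt w ↔ v = w ∨ v = w + 1 := by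
  constructor
  · intro h
    have hmem : ((v.val : ℝ) : AddCircle (m : ℝ)) ∈ pointAt v := ⟨_, ⟨le_rfl, le_rfl⟩, rfl⟩
    obtain ⟨z, h1, h2⟩ := coe_mem_interval_iff.mp (h hmem)
    have h1' : (w.val : ℤ) ≤ (v.val : ℤ) - z * m := by exact_mod_cast h1
    have h2' : (v.val : ℤ) - z * m ≤ w.val + 1 := by exact_mod_cast h2
    rcases h1'.eq_or_lt with h3 | h3
    · exact Or.inl (by simpa using
        eq_add_natCast_of_val_sub (v := v) (w := w) (z := z) (c := 0) (by push_cast; linarith))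
    · exact Or.inr (by simpa using
        eq_add_natCast_of_val_sub (v := v) (w := w) (z := z) (c := 1) (by push_cast; linarith))
  · intro h
    obtain ⟨c, hc, hv⟩ : ∃ c : ℕ, c ≤ 1 ∧ v = w + c := by
      rcases h with h | h
      · exact ⟨0, by simp, by simpa using h⟩
      · exact ⟨1, le_rfl, by simpa using h⟩
    obtain ⟨z, hz⟩ := exists_int_of_eq_add hv
    have hz' : (v.val : ℝ) - z * m = w.val + c := by exact_mod_cast hz
    have hc' : (c : ℝ) ≤ 1 := by exact_mod_cast hc
    rintro _ ⟨y, ⟨hy1, hy2⟩, rfl⟩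
    obtain rfl : y = v.val := le_antisymm hy2 hy1
    exact coe_mem_interval_iff.mpr ⟨z, by rw [hz']; simp, by rw [hz']; linarith⟩

theorem pointAt_subset_pointAt_iff {v w : ZMod m} : pointAt v ⊆ pointAt w ↔ v = w := by
  refine ⟨fun h => ?_, fun h => h ▸ subset_rfl⟩
  have hmem : ((v.val : ℝ) : AddCircle (m : ℝ)) ∈ pointAt v := ⟨_, ⟨le_rfl, le_rfl⟩, rfl⟩
  obtain ⟨z, h1, h2⟩ := coe_mem_interval_iff.mp (h hmem)
  have h3 : (v.val : ℤ) - z * m = w.val := by exact_mod_cast le_antisymm h2 h1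
  simpa using eq_add_natCast_of_val_sub (v := v) (w := w) (z := z) (c := 0) (by simpa using h3)

omit [NeZero m] in
theorem not_unitAt_subset_pointAt (v w : ZMod m) : ¬ unitAt v ⊆ pointAt w := by
  intro h
  have hmem : (((v.val : ℝ) + 1 / 2 : ℝ) : AddCircle (m : ℝ)) ∈ unitAt v :=
    ⟨_, ⟨by linarith, by linarith⟩, rfl⟩
  obtain ⟨z, h1, h2⟩ := coe_mem_interval_iff.mp (h hmem)
  have h3 : (2 : ℝ) * v.val + 1 - 2 * z * m = 2 * w.val := by linarith
  have h4 : (2 : ℤ) * v.val + 1 - 2 * (z * m) = 2 * w.val := by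
    rw [← mul_assoc]
    exact_mod_cast h3
  omega

end Intervals

section Cubes

variable {q : ℕ} (n : Fin q → ℕ) [∀ i, NeZero (n i)]

/-- The `q`-cube with lowest vertex `v`. -/
def cubeAt (v : ∀ i, ZMod (n i)) : Set (Torus n) := Set.univ.pi fun i => unitAt (v i)

/-- The `(q-1)`-cube with lowest vertex `v` that is orthogonal to direction `i`. -/
def wallAt (i : Fin q) (v : ∀ i, ZMod (n i)) : Set (Torus n) :=
  Set.univ.pi fun j => if j = i then pointAt (v j) else unitAt (v j)

theorem mem_cubes_self_iff {c : Set (Torus n)} : c ∈ cubes n q ↔ ∃ v, c = cubeAt n v := by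
  constructor
  · rintro ⟨s, hs, I, hI, rfl⟩
    have hs : s = Finset.univ := by
      rw [← Finset.card_eq_iff_eq_univ, hs, Fintype.card_fin]
    choose v hv using fun i => mem_unitIntervals_iff.mp ((hI i).1 (by simp [hs]))
    exact ⟨v, by rw [cubeAt, funext hv]⟩
  · rintro ⟨v, rfl⟩
    exact ⟨Finset.univ, by simp, _,
      fun i => ⟨fun _ => mem_unitIntervals_iff.mpr ⟨v i, rfl⟩, by simp⟩, rfl⟩

theorem mem_cubes_pred_iff (hq : 1 ≤ q) {c : Set (Torus n)} :
    c ∈ cubes n (q - 1) ↔ ∃ i v, c = wallAt n i v := by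
  constructor
  · rintro ⟨s, hs, I, hI, rfl⟩
    have hs : sᶜ.card = 1 := by
      rw [Finset.card_compl, hs, Fintype.card_fin]
      omega
    obtain ⟨i, hi⟩ := Finset.card_eq_one.mp hs
    have hmem : ∀ j, j ∈ s ↔ j ≠ i := by
      intro j
      rw [← not_iff_not, ← Finset.mem_compl, hi]
      simp
    have hex : ∀ j, ∃ v : ZMod (n j), I j = if j = i then pointAt v else unitAt v := by
      intro j
      split_ifs with h
      · exact mem_pointIntervals_iff.mp ((hI j).2 (by simp [hmem, h]))
      · exact mem_unitIntervals_iff.mp ((hI j).1 (by simp [hmem, h]))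
    choose v hv using hex
    exact ⟨i, v, by rw [wallAt, funext hv]⟩
  · rintro ⟨i, v, rfl⟩
    refine ⟨Finset.univ.erase i, by simp, _, fun j => ⟨fun h => ?_, fun h => ?_⟩, rfl⟩
    · simp only [(Finset.mem_erase.mp h).1, if_false]
      exact mem_unitIntervals_iff.mpr ⟨v j, rfl⟩
    · obtain rfl : j = i := by simpa using h
      simp only [if_true]
      exact mem_pointIntervals_iff.mpr ⟨v j, rfl⟩

theorem cubeAt_injective : Function.Injective (cubeAt n) := by
  intro v w h
  funext i
  rcases Set.univ_pi_subset_univ_pi_iff.mp h.le with h | ⟨j, hj⟩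
  · exact unitAt_subset_unitAt_iff.mp (h i)
  · exact absurd hj (unitAt_nonempty _).ne_empty

omit [∀ i, NeZero (n i)] in
theorem wallAt_factor_nonempty (i j : Fin q) (v : ∀ i, ZMod (n i)) :
    (if j = i then pointAt (v j) else unitAt (v j)).Nonempty := by
  split_ifs
  · exact pointAt_nonempty _
  · exact unitAt_nonempty _

theorem wallAt_eq_iff {i j : Fin q} {v w : ∀ i, ZMod (n i)} :
    wallAt n i v = wallAt n j w ↔ i = j ∧ v = w := by
  refine ⟨fun h => ?_, fun h => by rw [h.1, h.2]⟩
  rcases Set.univ_pi_subset_univ_pi_iff.mp h.le with h | ⟨k, hk⟩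
  · have hij : i = j := by
      by_contra hne
      have := h j
      rw [if_neg (Ne.symm hne), if_pos rfl] at this
      exact not_unitAt_subset_pointAt _ _ this
    subst hij
    refine ⟨rfl, funext fun k => ?_⟩
    have := h k
    split_ifs at this
    · exact pointAt_subset_pointAt_iff.mp this
    · exact unitAt_subset_unitAt_iff.mp this
  · exact absurd hk (wallAt_factor_nonempty n i k v).ne_empty

theorem wallAt_subset_cubeAt_iff {i : Fin q} {v w : ∀ i, ZMod (n i)} :
    wallAt n i v ⊆ cubeAt n w ↔ v = w ∨ v = unitShift n i w := by
  have hshift : ∀ j, unitShift n i w j = if j = i then w j + 1 else w j := by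
    intro j
    by_cases h : j = i
    · subst h
      simp [unitShift]
    · simp [unitShift, h]
  rw [wallAt, cubeAt, Set.univ_pi_subset_univ_pi_iff]
  constructor
  · rintro (h | ⟨k, hk⟩)
    · have hoff : ∀ j, j ≠ i → v j = w j := fun j hj => by
        have := h j
        rw [if_neg hj] at this
        exact unitAt_subset_unitAt_iff.mp this
      have hi := h i
      rw [if_pos rfl] at hi
      rcases pointAt_subset_unitAt_iff.mp hi with hi | hi
      · refine Or.inl (funext fun j => ?_)
        by_cases hj : j = i
        · rw [hj, hi]
        · exact hoff j hj
      · refine Or.inr (funext fun j => ?_)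
        rw [hshift]
        split_ifs with hj
        · rw [hj, hi]
        · exact hoff j hj
    · exact absurd hk (wallAt_factor_nonempty n i k v).ne_empty
  · intro h
    refine Or.inl fun j => ?_
    split_ifs with hj
    · rw [pointAt_subset_unitAt_iff]
      rcases h with rfl | rfl
      · exact Or.inl rfl
      · exact Or.inr (by rw [hshift, if_pos hj])
    · rw [unitAt_subset_unitAt_iff]
      rcases h with rfl | rfl
      · rfl
      · rw [hshift, if_neg hj]

open Matrix

/-- The face of the cube at `v` in direction `s`. -/
def faceAt (v : ∀ i, ZMod (n i)) (s : Fin q × Bool) : Set (Torus n) :=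
  wallAt n s.1 (if s.2 then unitShift n s.1 v else v)

omit [∀ i, NeZero (n i)] in
theorem faceAt_dirStep (v : ∀ i, ZMod (n i)) (s : Fin q × Bool) :
    faceAt n (dirStep (unitShift n) s v) (dirFlip s) = faceAt n v s := by
  rcases s with ⟨i, b⟩
  cases b <;> simp [faceAt, dirFlip, dirStep]

/-- This makes walls the edges of a graph: the cubes containing a wall are just those on its two
sides. -/
theorem faceAt_subset_cubeAt_iff {v w : ∀ i, ZMod (n i)} {s : Fin q × Bool} :
    faceAt n v s ⊆ cubeAt n w ↔ w = v ∨ w = dirStep (unitShift n) s v := by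
  rw [faceAt, wallAt_subset_cubeAt_iff]
  rcases s with ⟨i, b⟩
  cases b
  · simp [dirStep, Equiv.eq_symm_apply, eq_comm]
  · simp [dirStep, eq_comm, or_comm]

theorem mem_cubes_pred_and_subset_iff (hq : 1 ≤ q) {c : Set (Torus n)} {v : ∀ i, ZMod (n i)} :
    c ∈ cubes n (q - 1) ∧ c ⊆ cubeAt n v ↔ ∃ s, c = faceAt n v s := by
  constructor
  · rintro ⟨h1, h2⟩
    obtain ⟨i, w, rfl⟩ := (mem_cubes_pred_iff n hq).mp h1
    rcases (wallAt_subset_cubeAt_iff n).mp h2 with rfl | rfl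
    · exact ⟨(i, false), by simp [faceAt]⟩
    · exact ⟨(i, true), by simp [faceAt]⟩
  · rintro ⟨s, rfl⟩
    exact ⟨(mem_cubes_pred_iff n hq).mpr ⟨_, _, rfl⟩,
      (faceAt_subset_cubeAt_iff n).mpr (Or.inl rfl)⟩

variable {n} (hn : ∀ i, 2 ≤ n i)
include hn

omit [∀ i, NeZero (n i)] in
theorem unitShift_ne (i : Fin q) (v : ∀ i, ZMod (n i)) : unitShift n i v ≠ v := by
  intro h
  have h := congrFun h i
  have : Fact (1 < n i) := ⟨hn i⟩
  simp [unitShift] at h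

omit [∀ i, NeZero (n i)] in
theorem dirStep_ne (s : Fin q × Bool) (v : ∀ i, ZMod (n i)) : dirStep (unitShift n) s v ≠ v := by
  rcases s with ⟨i, b⟩
  cases b
  · simp only [dirStep, Bool.false_eq_true, if_false, ne_eq, Equiv.symm_apply_eq]
    exact (unitShift_ne hn i v).symm
  · exact unitShift_ne hn i v

/-- The opposite faces differ because `n_i ≥ 2`. For `n_i = 2` they separate the same two cubes, yet
remain different edges. -/
theorem faceAt_injective (v : ∀ i, ZMod (n i)) : Function.Injective (faceAt n v) := by
  rintro ⟨i, b⟩ ⟨j, c⟩ h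
  obtain ⟨h1, h2⟩ := (wallAt_eq_iff n).mp h
  simp only at h1 h2
  subst h1
  have := unitShift_ne hn i v
  cases b <;> cases c <;> simp_all [eq_comm]

end Cubes

/-! ### Closed geodesics as closed chains of oriented edges -/

section Geodesics

open Matrix

variable {q : ℕ} (n : Fin q → ℕ)

/-- Consecutive entries of a geodesic in the top-dimensional skeleton. -/
def GeodesicRel (a b : CubePair n) : Prop :=
  (a.1 ∈ cubes n (q - 1) ∧ a.2 ∈ cubes n q) ∧ (a.1 ≠ b.1 ∧ b.1 ⊆ a.2 ∩ b.2) ∧ a.2 ≠ b.2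

/-- `GeodesicRel` tests the dimensions of its first argument only; this suffices since on a cycle
every entry has a successor. -/
theorem isClosedGeodesic_iff (l : List (CubePair n)) :
    IsClosedGeodesic n q l ↔ IsClosedChain (GeodesicRel n) l := by
  unfold IsClosedGeodesic IsClosedPath IsClosedChain
  simp only [Cycle.chain_coe_iff_periodicSeq]
  constructor
  · rintro ⟨⟨h0, h1, h2⟩, h3⟩
    exact ⟨h0, fun i a b ha hb => ⟨h1 a (List.mem_of_getElem? ha), h2 i a b ha hb, h3 i a b ha hb⟩⟩
  · rintro ⟨h0, h⟩
    refine ⟨⟨h0, fun a ha => ?_, fun i a b ha hb => (h i a b ha hb).2.1⟩,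
      fun i a b ha hb => (h i a b ha hb).2.2⟩
    obtain ⟨i, hi, rfl⟩ := List.getElem_of_mem ha
    refine (h i _ (l[(i + 1) % l.length]'(Nat.mod_lt _ (by omega))) ?_ ?_).1
    · rw [List.periodicSeq, Nat.mod_eq_of_lt hi, List.getElem?_eq_getElem]
    · rw [List.periodicSeq, List.getElem?_eq_getElem]

theorem cyclicProperty_isClosedGeodesic : CyclicProperty (IsClosedGeodesic n q) := by
  rw [show IsClosedGeodesic n q = IsClosedChain (GeodesicRel n) from
    funext fun c => propext (isClosedGeodesic_iff n c)]
  exact cyclicProperty_isClosedChain _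

variable [∀ i, NeZero (n i)]

/-- The pair consisting of a cube and the face through which it is entered in direction `s`. -/
def edgePair (x : (∀ i, ZMod (n i)) × (Fin q × Bool)) : CubePair n :=
  (faceAt n x.1 (dirFlip x.2), cubeAt n x.1)

variable {n}

theorem edgePair_injective (hn : ∀ i, 2 ≤ n i) : Function.Injective (edgePair n) := by
  rintro ⟨v, s⟩ ⟨w, t⟩ h
  obtain ⟨h1, h2⟩ := Prod.mk.inj h
  obtain rfl := cubeAt_injective n h2
  have := congrArg dirFlip (faceAt_injective hn v h1)
  rw [dirFlip_dirFlip, dirFlip_dirFlip] at this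
  simp only at this
  rw [this]

/-- Changing the cube forces the walk to cross the common face, and changing the face forbids
leaving through the face of entry. -/
theorem geodesicRel_edgePair_iff (hq : 1 ≤ q) (hn : ∀ i, 2 ≤ n i)
    (x y : (∀ i, ZMod (n i)) × (Fin q × Bool)) :
    GeodesicRel n (edgePair n x) (edgePair n y) ↔ EdgeRel (unitShift n) x y := by
  obtain ⟨v, s⟩ := x
  obtain ⟨w, t⟩ := y
  have hx : faceAt n v (dirFlip s) ∈ cubes n (q - 1) :=
    ((mem_cubes_pred_and_subset_iff n hq).mpr ⟨_, rfl⟩).1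
  have hcube : cubeAt n v ∈ cubes n q := (mem_cubes_self_iff n).mpr ⟨v, rfl⟩
  simp only [GeodesicRel, edgePair, EdgeRel, hx, hcube, true_and, Set.subset_inter_iff,
    faceAt_subset_cubeAt_iff, true_or, and_true, (cubeAt_injective n).ne_iff]
  constructor
  · rintro ⟨⟨h1, h2⟩, h3⟩
    have hv := h2.resolve_left h3
    have hw : w = dirStep (unitShift n) t v := by rw [hv]; simp
    refine ⟨hw, ?_⟩
    rintro rfl
    rw [hw, faceAt_dirStep] at h1
    exact h1 rfl
  · rintro ⟨rfl, h2⟩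
    rw [faceAt_dirStep]
    refine ⟨⟨fun h => h2 (faceAt_injective hn v h).symm, Or.inr (by simp)⟩, ?_⟩
    exact (dirStep_ne hn t v).symm

theorem mem_range_edgePair (hq : 1 ≤ q) {b : CubePair n} (h1 : b.1 ∈ cubes n (q - 1))
    (h2 : b.2 ∈ cubes n q) (h : b.1 ⊆ b.2) : b ∈ Set.range (edgePair n) := by
  obtain ⟨c, d⟩ := b
  obtain ⟨v, rfl⟩ := (mem_cubes_self_iff n).mp h2
  obtain ⟨s, rfl⟩ := (mem_cubes_pred_and_subset_iff n hq).mp ⟨h1, h⟩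
  exact ⟨(v, dirFlip s), by simp [edgePair]⟩

omit [∀ i, NeZero (n i)] in
theorem subset_of_mem_isClosedGeodesic {l : List (CubePair n)} (hl : IsClosedGeodesic n q l)
    {b : CubePair n} (hb : b ∈ l) : b.1 ⊆ b.2 := by
  have h := (Cycle.chain_coe_iff_periodicSeq _ _).mp hl.1.2.2
  obtain ⟨i, hi, rfl⟩ := List.getElem_of_mem hb
  have hlen : 0 < l.length := by omega
  -- The inclusion comes from the condition at the cyclic predecessor, whose index is `i - 1` modulo
  -- the length.
  refine ((h (i + (l.length - 1)) (l[(i + (l.length - 1)) % l.length]'(Nat.mod_lt _ hlen)) l[i]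
    ?_ ?_).2).trans Set.inter_subset_right
  · rw [List.periodicSeq, List.getElem?_eq_getElem]
  · rw [List.periodicSeq, add_assoc, Nat.sub_add_cancel hlen, Nat.add_mod_right,
      Nat.mod_eq_of_lt hi, List.getElem?_eq_getElem]

theorem isClosedGeodesic_map_edgePair_iff (hq : 1 ≤ q) (hn : ∀ i, 2 ≤ n i)
    (l : List ((∀ i, ZMod (n i)) × (Fin q × Bool))) :
    IsClosedGeodesic n q (l.map (edgePair n)) ↔ IsClosedChain (EdgeRel (unitShift n)) l := by
  rw [isClosedGeodesic_iff, IsClosedChain, IsClosedChain, ← Cycle.map_coe, Cycle.chain_map]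
  simp only [geodesicRel_edgePair_iff hq hn, ne_eq, List.map_eq_nil_iff]

theorem bijective_map_edgePair (hq : 1 ≤ q) (hn : ∀ i, 2 ≤ n i) :
    Function.Bijective (fun l : {l // IsClosedChain (EdgeRel (unitShift n)) l} =>
      (⟨l.1.map (edgePair n), (isClosedGeodesic_map_edgePair_iff hq hn l.1).mpr l.2⟩ :
        {c // IsClosedGeodesic n q c})) := by
  constructor
  · intro l l' h
    exact Subtype.ext (List.map_injective_iff.mpr (edgePair_injective hn)
      (congrArg Subtype.val h))
  · rintro ⟨c, hc⟩
    have : c ∈ Set.range (List.map (edgePair n)) := by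
      rw [Set.range_list_map]
      intro b hb
      obtain ⟨h1, h2⟩ := hc.1.2.1 b hb
      exact mem_range_edgePair hq h1 h2 (subset_of_mem_isClosedGeodesic hc hb)
    obtain ⟨l, rfl⟩ := this
    exact ⟨⟨l, (isClosedGeodesic_map_edgePair_iff hq hn l).mp hc⟩, rfl⟩

end Geodesics

end CubicalLattice

/-! ### Assembly of the formula -/

theorem mainTheorem3 (q : ℕ) (hq : 1 ≤ q) (n : Fin q → ℕ) (hn : ∀ i, 2 ≤ n i) :
    ∃ r : ℝ, 0 < r ∧ ∀ u : ℂ, ‖u‖ < r →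
      Multipliable (CubicalLattice.eulerFactor n q u) ∧
      (CubicalLattice.zeta n q u)⁻¹ =
        (1 - u ^ 2) ^ ((q - 1) * ∏ i, n i) *
          ∏ d ∈ Fintype.piFinset (fun i => (n i).divisors),
            (MvPolynomial.aeval ![1 + (2 * (q : ℂ) - 1) * u ^ 2, u] (CubicalLattice.Psi d)) ^
              CubicalLattice.eps d := by
  have : ∀ i, NeZero (n i) := fun i => ⟨by have := hn i; omega⟩
  obtain ⟨r, hr, H⟩ := exists_hasSum_isClosedChain (Matrix.EdgeRel (unitShift n))
  refine ⟨min r 1, lt_min hr one_pos, fun u hu => ?_⟩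
  have hu1 : ‖u‖ < 1 := hu.trans_le (min_le_right _ _)
  obtain ⟨S, hS, hexp⟩ := H u (hu.trans_le (min_le_left _ _))
  have hS' : HasSum (fun c : {c // CubicalLattice.IsClosedGeodesic n q c} =>
      u ^ c.1.length / c.1.length) S := by
    rw [← (Equiv.ofBijective _ (CubicalLattice.bijective_map_edgePair hq hn)).hasSum_iff]
    refine hS.congr_fun fun l => ?_
    simp
  have hprod : HasProd (CubicalLattice.eulerFactor n q u) (Complex.exp S) :=
    (CubicalLattice.cyclicProperty_isClosedGeodesic n).hasProd_eulerFactor hu1 hS'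
  refine ⟨hprod.multipliable, ?_⟩
  have hne : 1 - u ^ 2 ≠ 0 := by
    intro h
    have h1 : ‖u ^ 2‖ < 1 := by
      rw [norm_pow]
      exact pow_lt_one₀ (norm_nonneg u) hu1 two_ne_zero
    rw [← sub_eq_zero.mp h] at h1
    simp at h1
  have hbass := Matrix.bass_formula (unitShift n) hne
  have hcard : Fintype.card (∀ i, ZMod (n i)) = ∏ i, n i := by
    simp [Fintype.card_pi, ZMod.card]
  rw [hcard, Fintype.card_fin] at hbass
  rw [CubicalLattice.zeta, hprod.tprod_eq, hexp, inv_inv,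
    ← CubicalLattice.det_smul_one_sub_dirAdj_eq_prod_Psi]
  -- Bass's formula carries `(1 - u²)^|n|` on the left; restoring it avoids dividing powers.
  refine mul_left_cancel₀ (pow_ne_zero (∏ i, n i) hne) ?_
  rw [hbass, ← mul_assoc, ← pow_add]
  congr 2
  obtain ⟨p, rfl⟩ := Nat.exists_eq_add_of_le hq
  rw [Nat.add_sub_cancel_left]
  ring
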